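/- All graphs are finite, simple and undirected. Let $G$ be a graph with a perfect matching. A *global forcing set* of $G$ is a set $S\subseteq E(G)$ with $S\cap M_1\ne S\cap M_2$ for all distinct perfect matchings $M_1,M_2$ of $G$; $gf(G)$ is the smallest size of such a set. An *anti-forcing set* of a perfect matching $M$ of $G$ is a set $S\subseteq E(G)\setminus M$ such that $M$ is the only perfect matching of $G-S$; $af(G,M)$ is the smallest size of such a set, and $Af(G)$ is the maximum of $af(G,M)$ over all perfect matchings $M$ of $G$. A *bisubdivision* of $G$ on $S\subseteq E(G)$ is obtained by replacing each edge in $S$ by a path of odd length $\ge 1$, these paths being internally disjoint. A *quadrilateral subdivision* of $G$ on $S$ is obtained by replacing each edge $e=uw$ in $S$ by a path $u v_1v_2\dots v_{4k}w$ of length $4k+1$ (internally disjoint paths, with $k=k(e)\ge 0$ depending on $e$), adding the $k$ edges $v_1v_4, v_5v_8,\dots,v_{4k-3}v_{4k}$, and then performing a bisubdivision on the edges of these paths. Each graph below consists of a Hamilton cycle $v_1v_2\dots v_nv_1$ and the listed chords; $ij$ (or $i\text{-}j$) denotes the edge $v_iv_j$. Unless other replaceable sets are given, the only *replaceable set* is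 the set of all edges of the cycle $v_1v_2\dots v_nv_1$; "irreplaceable: $X$" means that the only replaceable set consists of all edges of this cycle not in $X$. *Strong replaceable sets* are given where they exist. * $H_1$: $n=4$; chords $13,24$. * $H_2$: $n=8$; chords $15,37,26$. * $H_3$: $n=6$; chords $15,46,26$. * $H_4$: $n=8$; chords $13,15,26,28$. * $H_5$: $n=10$; chords $1\text-5,1\text-7,2\text-8,4\text-10$. * $H_6$: $n=12$; chords $5\text-11,6\text-12,2\text-8,3\text-9$. * $H_7$: $n=8$; chords $15,26,37,48$. * $H_{1,1}$: $n=8$; chords $13,24,58$; strong: $\{23,45,81\}$. * $H_{1,2}$: $n=8$; chords $15,46,27$; irreplaceable: $12,45,67$. * $H_{1,3}$: $n=8$; chords $15,26,38$; two replaceable sets $\{12,34,45,67,78\}$ and $\{18,23,34,45,67,78\}$; strong: $\{18,23\}$. * $H_{1,4}$: $n=6$; chords $13,24,14$; irreplaceable: $23$; two strong sets $\{12,34\}$ and $\{16,45\}$. * $H_{1,5}$: $n=6$; chords $13,24,25$; two replaceable sets $\{23,45,56,61\}$ and $\{34,56,61\}$; strong: $\{23,45\}$. * $H_{2,1}$: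 $n=12$; chords $1\text-5,3\text-11,2\text-6,7\text-10$; strong: $\{2\text-3,6\text-7,10\text-11\}$. * $H_{3,1}$: $n=6$; chords $15,46,26,14$; irreplaceable: $12,56$; strong: $\{45,61\}$. * $H_{3,2}$: $n=10$; chords $1\text-5,4\text-10,2\text-10,6\text-9$; strong: $\{1\text-2,5\text-6,9\text-10\}$. * $H_{3,3}$: $n=10$; chords $1\text-9,4\text-10,2\text-10,5\text-8$; strong: $\{4\text-5,8\text-9,10\text-1\}$. * $H_{4,1}$: $n=12$; chords $4\text-6,2\text-6,5\text-11,1\text-5,7\text-10$; strong: $\{4\text-5,6\text-7,10\text-11\}$. * $H_{4,2}$: $n=12$; chords $2\text-8,4\text-8,1\text-5,1\text-7,9\text-12$; strong: $\{4\text-5,8\text-9,12\text-1\}$. * $H_{4,3}$: $n=12$; chords $5\text-7,5\text-9,2\text-6,4\text-6,1\text-10$; strong: $\{1\text-2,5\text-6,9\text-10\}$. * $H_{5,1}$: $n=14$; chords $5\text-13,1\text-5,2\text-6,4\text-8,9\text-12$; strong: $\{4\text-5,8\text-9,12\text-13\}$. * $H_{5,2}$: $n=14$; chords $1\text-5,1\text-7,2\text-8,4\text-10,11\text-14$;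 strong: $\{4\text-5,10\text-11,14\text-1\}$. * $H_{6,1}$: $n=16$; chords $1\text-7,2\text-8,4\text-10,5\text-15,11\text-14$; strong: $\{4\text-5,10\text-11,14\text-15\}$. * $H_{1,4,5}$: $n=6$; chords $13,24,14,25$; irreplaceable: $12,23,34,45$. * $H_{3,1,1}$: $n=6$; chords $15,46,26,14,25$; irreplaceable: $12,45,56,16$. * $H_{3,4}$: $n=10$; chords $1\text-7,4\text-8,5\text-10,1\text-4$; irreplaceable: $7\text-8,1\text-10,4\text-5$. * $H_{4,5}$: $n=8$; chords $15,46,16,25$; irreplaceable: $12,45,56$. Let $\mathcal G_0$, $\mathcal G_1$ and $\mathcal G_2$ be the sets of graphs obtained by a bisubdivision on a replaceable set from one of $H_1,\dots,H_7$, from one of the fifteen graphs $H_{i,j}$ among $H_{1,1},\dots,H_{6,1}$, and from one of $H_{1,4,5},H_{3,1,1}$, respectively. Let $\mathcal G_3$ be the set of graphs obtained from $H_{3,4}$ or $H_{4,5}$ by a bisubdivision on a replaceable set, together with the graphs obtained from one of $H_{1,1},\dots,H_{6,1}$ other than $H_{1,2}$ by performing a bisubdivision on a replaceable set and a quadrilateral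 subdivision on a strong replaceable set. **Lemma.** Every graph $G\in\mathcal G_0\cup\mathcal G_1\cup\mathcal G_2\cup\mathcal G_3$ has a perfect matching and satisfies $gf(G)=Af(G)$. -/

import Mathlib

/-! ## Perfect matchings, anti-forcing and global forcing numbers -/

/-- `S` is an anti-forcing set of the perfect matching `M` of `G`: `S` consists of edges of `G`
outside `M`, and `M` is the only perfect matching of `G - S`. (As `S` avoids `M`, the matching `M`
is always a perfect matching of `G - S`.) -/
def IsAntiForcingSet {V : Type*} (G : SimpleGraph V) (M : G.Subgraph) (S : Finset (Sym2 V)) :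
    Prop :=
  (S : Set (Sym2 V)) ⊆ G.edgeSet \ M.edgeSet ∧
    ∀ N : (G.deleteEdges (S : Set (Sym2 V))).Subgraph,
      N.IsPerfectMatching → N.edgeSet = M.edgeSet

/-- `af(G, M)`: the smallest size of an anti-forcing set of `M`. -/
noncomputable def antiForcingNumber {V : Type*} (G : SimpleGraph V) (M : G.Subgraph) : ℕ :=
  sInf {k | ∃ S : Finset (Sym2 V), IsAntiForcingSet G M S ∧ S.card = k}

/-- `Af(G)`: the largest anti-forcing number of a perfect matching of `G`. -/
noncomputable def maxAntiForcingNumber {V : Type*} (G : SimpleGraph V) : ℕ :=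
  sSup {k | ∃ M : G.Subgraph, M.IsPerfectMatching ∧ antiForcingNumber G M = k}

/-- `S` is a global forcing set of `G`: a set of edges of `G` whose intersections with distinct
perfect matchings of `G` are distinct. -/
def IsGlobalForcingSet {V : Type*} (G : SimpleGraph V) (S : Finset (Sym2 V)) : Prop :=
  (S : Set (Sym2 V)) ⊆ G.edgeSet ∧
    ∀ M₁ M₂ : G.Subgraph, M₁.IsPerfectMatching → M₂.IsPerfectMatching → M₁ ≠ M₂ →
      (S : Set (Sym2 V)) ∩ M₁.edgeSet ≠ (S : Set (Sym2 V)) ∩ M₂.edgeSet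

/-- `gf(G)`: the smallest size of a global forcing set of `G`. -/
noncomputable def globalForcingNumber {V : Type*} (G : SimpleGraph V) : ℕ :=
  sInf {k | ∃ S : Finset (Sym2 V), IsGlobalForcingSet G S ∧ S.card = k}

/-! ## Bisubdivisions and quadrilateral subdivisions -/

/-- The edges of `G` are replaced by internally disjoint paths in `G'`: the vertices of `G` are
embedded in `G'`, every edge `uv` of `G` gets a path of `G'` between the images of `u` and `v`
(the two orientations of an edge get reverse paths), no path has an interior vertex in common with
another path or with the image of `V`, and every vertex of `G'` is used. Lengths of the paths and
further edges of `G'` are constrained separately. -/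
structure PathReplacement {V W : Type*} (G : SimpleGraph V) (G' : SimpleGraph W) where
  branch : V ↪ W
  path : ∀ {u v : V}, G.Adj u v → G'.Walk (branch u) (branch v)
  isPath : ∀ {u v : V} (h : G.Adj u v), (path h).IsPath
  path_symm : ∀ {u v : V} (h : G.Adj u v), path h.symm = (path h).reverse
  branch_mem : ∀ {u v : V} (h : G.Adj u v) (x : V), branch x ∈ (path h).support → x = u ∨ x = v
  disjoint : ∀ {u v a b : V} (h : G.Adj u v) (h' : G.Adj a b), s(u, v) ≠ s(a, b) →
    ∀ w, w ∈ (path h).support → w ∈ (path h').support → w ∈ Set.range branch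
  cover : ∀ w, w ∈ Set.range branch ∨ ∃ (u v : V) (h : G.Adj u v), w ∈ (path h).support

/-- All edges of `G'` lying on the replacement paths of the edges in `S`. -/
def PathReplacement.pathEdges {V W : Type*} {G : SimpleGraph V} {G' : SimpleGraph W}
    (P : PathReplacement G G') (S : Set (Sym2 V)) : Set (Sym2 W) :=
  {f | ∃ (u v : V) (h : G.Adj u v), s(u, v) ∈ S ∧ f ∈ (P.path h).edges}

/-- `G'` is a bisubdivision of `G` on `S`: it arises from `G` by replacing each edge in `S` by a
path of odd length (length one is allowed), these paths being internally disjoint. -/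
def IsBisubdivision {V W : Type*} (G : SimpleGraph V) (S : Set (Sym2 V)) (G' : SimpleGraph W) :
    Prop :=
  ∃ P : PathReplacement G G',
    (∀ {u v : V} (h : G.Adj u v), Odd (P.path h).length) ∧
    (∀ {u v : V} (h : G.Adj u v), s(u, v) ∉ S → (P.path h).length = 1) ∧
    G'.edgeSet = P.pathEdges Set.univ

/-- `P` exhibits `G'` as obtained from `G` by replacing each edge `e = uw` in `S` by a path
`u v₁ v₂ … v_{4k} w` of length `4k + 1`, with `k = k(e) ≥ 0`, and adding the `k` edges
`v₁v₄, v₅v₈, …, v_{4k-3}v_{4k}`. (This set of added edges does not depend on the direction in which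
the path is read.) -/
def PathReplacement.IsQuadrilateralInsertion {V W : Type*} {G : SimpleGraph V} {G' : SimpleGraph W}
    (P : PathReplacement G G') (S : Set (Sym2 V)) : Prop :=
  ∃ k : Sym2 V → ℕ,
    (∀ e, e ∉ S → k e = 0) ∧
    (∀ {u v : V} (h : G.Adj u v), (P.path h).length = 4 * k s(u, v) + 1) ∧
    G'.edgeSet = P.pathEdges Set.univ ∪
      {f | ∃ (u v : V) (h : G.Adj u v) (j : ℕ), j < k s(u, v) ∧
        f = s((P.path h).getVert (4 * j + 1), (P.path h).getVert (4 * j + 4))}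

/-- `G'` arises from `G` by a bisubdivision on `R` and a quadrilateral subdivision on `T`: each
edge in `T` is replaced by a path of length `4k + 1` with `k` additional edges as above, and then
the edges of these paths, as well as the (remaining) edges in `R`, are replaced by paths of odd
length. The added edges `v₁v₄, v₅v₈, …` are not subdivided. For `R = ∅` this is a quadrilateral
subdivision of `G` on `T`. -/
def IsQuadBisubdivision {V W : Type*} (G : SimpleGraph V) (R T : Set (Sym2 V))
    (G' : SimpleGraph W) : Prop :=
  ∃ (n : ℕ) (G₁ : SimpleGraph (Fin n)) (P : PathReplacement G G₁),
    P.IsQuadrilateralInsertion T ∧ IsBisubdivision G₁ (P.pathEdges (R ∪ T)) G'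

/-! ## The fundamental graphs

All of them consist of a Hamilton cycle `v₁ v₂ … v_n v₁` with chords. The vertex `v_i` is the
element `i - 1` of `Fin n`, and a pair `(i, j)` stands for the edge `v_i v_j`. -/

/-- The set of edges `v_i v_j` with `(i, j)` in the list. -/
def labelledEdges (n : ℕ) (L : List (ℕ × ℕ)) : Set (Sym2 (Fin n)) :=
  {e | ∃ a b : Fin n, (a.val + 1, b.val + 1) ∈ L ∧ e = s(a, b)}

/-- The edges `v₁v₂, v₂v₃, …, v_nv₁`. -/
def cyclePairs (n : ℕ) : List (ℕ × ℕ) :=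
  (List.range n).map fun i => (i + 1, (i + 1) % n + 1)

/-- The edges of the cycle `v₁ v₂ … v_n v₁` except those in `L`. -/
def cyclePairsExcept (n : ℕ) (L : List (ℕ × ℕ)) : List (ℕ × ℕ) :=
  (cyclePairs n).filter fun p => p ∉ L

/-- A Hamilton cycle with chords, together with the list of its replaceable sets and the list of
its strong replaceable sets. -/
structure FundamentalGraph where
  order : ℕ
  chords : List (ℕ × ℕ)
  replaceable : List (List (ℕ × ℕ))
  strong : List (List (ℕ × ℕ))

/-- The underlying graph: the cycle `v₁ v₂ … v_n v₁` together with the chords. -/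
def FundamentalGraph.graph (F : FundamentalGraph) : SimpleGraph (Fin F.order) :=
  SimpleGraph.fromEdgeSet (labelledEdges F.order (cyclePairs F.order ++ F.chords))

namespace FundamentalGraph

def H1 : FundamentalGraph := ⟨4, [(1, 3), (2, 4)], [cyclePairs 4], []⟩

def H2 : FundamentalGraph := ⟨8, [(1, 5), (3, 7), (2, 6)], [cyclePairs 8], []⟩

def H3 : FundamentalGraph := ⟨6, [(1, 5), (4, 6), (2, 6)], [cyclePairs 6], []⟩

def H4 : FundamentalGraph := ⟨8, [(1, 3), (1, 5), (2, 6), (2, 8)], [cyclePairs 8], []⟩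

def H5 : FundamentalGraph := ⟨10, [(1, 5), (1, 7), (2, 8), (4, 10)], [cyclePairs 10], []⟩

def H6 : FundamentalGraph := ⟨12, [(5, 11), (6, 12), (2, 8), (3, 9)], [cyclePairs 12], []⟩

def H7 : FundamentalGraph := ⟨8, [(1, 5), (2, 6), (3, 7), (4, 8)], [cyclePairs 8], []⟩

def H11 : FundamentalGraph :=
  ⟨8, [(1, 3), (2, 4), (5, 8)], [cyclePairs 8], [[(2, 3), (4, 5), (8, 1)]]⟩

def H12 : FundamentalGraph :=
  ⟨8, [(1, 5), (4, 6), (2, 7)], [cyclePairsExcept 8 [(1, 2), (4, 5), (6, 7)]], []⟩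

def H13 : FundamentalGraph :=
  ⟨8, [(1, 5), (2, 6), (3, 8)],
    [[(1, 2), (3, 4), (4, 5), (6, 7), (7, 8)], [(8, 1), (2, 3), (3, 4), (4, 5), (6, 7), (7, 8)]],
    [[(8, 1), (2, 3)]]⟩

def H14 : FundamentalGraph :=
  ⟨6, [(1, 3), (2, 4), (1, 4)], [cyclePairsExcept 6 [(2, 3)]],
    [[(1, 2), (3, 4)], [(6, 1), (4, 5)]]⟩

def H15 : FundamentalGraph :=
  ⟨6, [(1, 3), (2, 4), (2, 5)],
    [[(2, 3), (4, 5), (5, 6), (6, 1)], [(3, 4), (5, 6), (6, 1)]], [[(2, 3), (4, 5)]]⟩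

def H21 : FundamentalGraph :=
  ⟨12, [(1, 5), (3, 11), (2, 6), (7, 10)], [cyclePairs 12], [[(2, 3), (6, 7), (10, 11)]]⟩

def H31 : FundamentalGraph :=
  ⟨6, [(1, 5), (4, 6), (2, 6), (1, 4)], [cyclePairsExcept 6 [(1, 2), (5, 6)]],
    [[(4, 5), (6, 1)]]⟩

def H32 : FundamentalGraph :=
  ⟨10, [(1, 5), (4, 10), (2, 10), (6, 9)], [cyclePairs 10], [[(1, 2), (5, 6), (9, 10)]]⟩

def H33 : FundamentalGraph :=
  ⟨10, [(1, 9), (4, 10), (2, 10), (5, 8)], [cyclePairs 10], [[(4, 5), (8, 9), (10, 1)]]⟩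

def H41 : FundamentalGraph :=
  ⟨12, [(4, 6), (2, 6), (5, 11), (1, 5), (7, 10)], [cyclePairs 12],
    [[(4, 5), (6, 7), (10, 11)]]⟩

def H42 : FundamentalGraph :=
  ⟨12, [(2, 8), (4, 8), (1, 5), (1, 7), (9, 12)], [cyclePairs 12], [[(4, 5), (8, 9), (12, 1)]]⟩

def H43 : FundamentalGraph :=
  ⟨12, [(5, 7), (5, 9), (2, 6), (4, 6), (1, 10)], [cyclePairs 12], [[(1, 2), (5, 6), (9, 10)]]⟩

def H51 : FundamentalGraph :=
  ⟨14, [(5, 13), (1, 5), (2, 6), (4, 8), (9, 12)], [cyclePairs 14], [[(4, 5), (8, 9), (12, 13)]]⟩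

def H52 : FundamentalGraph :=
  ⟨14, [(1, 5), (1, 7), (2, 8), (4, 10), (11, 14)], [cyclePairs 14],
    [[(4, 5), (10, 11), (14, 1)]]⟩

def H61 : FundamentalGraph :=
  ⟨16, [(1, 7), (2, 8), (4, 10), (5, 15), (11, 14)], [cyclePairs 16], [[(4, 5), (10, 11), (14, 15)]]⟩

def H145 : FundamentalGraph :=
  ⟨6, [(1, 3), (2, 4), (1, 4), (2, 5)],
    [cyclePairsExcept 6 [(1, 2), (2, 3), (3, 4), (4, 5)]], []⟩

def H311 : FundamentalGraph :=
  ⟨6, [(1, 5), (4, 6), (2, 6), (1, 4), (2, 5)],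
    [cyclePairsExcept 6 [(1, 2), (4, 5), (5, 6), (6, 1)]], []⟩

def H34 : FundamentalGraph :=
  ⟨10, [(1, 7), (4, 8), (5, 10), (1, 4)],
    [cyclePairsExcept 10 [(7, 8), (10, 1), (4, 5)]], []⟩

def H45 : FundamentalGraph :=
  ⟨8, [(1, 5), (4, 6), (1, 6), (2, 5)],
    [cyclePairsExcept 8 [(1, 2), (4, 5), (5, 6)]], []⟩

/-- The fundamental graphs of the family `𝒢₀`. -/
def list0 : List FundamentalGraph := [H1, H2, H3, H4, H5, H6, H7]

/-- The fundamental graphs of the family `𝒢₁`. -/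
def list1 : List FundamentalGraph :=
  [H11, H12, H13, H14, H15, H21, H31, H32, H33, H41, H42, H43, H51, H52, H61]

/-- The fundamental graphs of the family `𝒢₂`. -/
def list2 : List FundamentalGraph := [H145, H311]

/-- The fundamental graphs of `𝒢₃` that are only bisubdivided. -/
def list3 : List FundamentalGraph := [H34, H45]

/-- The fundamental graphs of `𝒢₃` that undergo quadrilateral subdivisions, too: those of `𝒢₁`
other than `H12`. -/
def list3' : List FundamentalGraph :=
  [H11, H13, H14, H15, H21, H31, H32, H33, H41, H42, H43, H51, H52, H61]

end FundamentalGraph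

/-! ## The families -/

/-- The graphs (on the vertex type `V`) obtained from a graph in the list by a bisubdivision on
one of its replaceable sets. -/
def bisubdivisionFamily (L : List FundamentalGraph) (V : Type*) : Set (SimpleGraph V) :=
  {G | ∃ F ∈ L, ∃ R ∈ F.replaceable, IsBisubdivision F.graph (labelledEdges F.order R) G}

/-- The graphs (on the vertex type `V`) obtained from a graph in the list by a bisubdivision on
one of its replaceable sets and a quadrilateral subdivision on one of its strong replaceable
sets. -/
def quadBisubdivisionFamily (L : List FundamentalGraph) (V : Type*) : Set (SimpleGraph V) :=
  {G | ∃ F ∈ L, ∃ R ∈ F.replaceable, ∃ T ∈ F.strong,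
    IsQuadBisubdivision F.graph (labelledEdges F.order R) (labelledEdges F.order T) G}

/-- The family `𝒢₀`. -/
def family0 (V : Type*) : Set (SimpleGraph V) := bisubdivisionFamily FundamentalGraph.list0 V

/-- The family `𝒢₁`. -/
def family1 (V : Type*) : Set (SimpleGraph V) := bisubdivisionFamily FundamentalGraph.list1 V

/-- The family `𝒢₂`. -/
def family2 (V : Type*) : Set (SimpleGraph V) := bisubdivisionFamily FundamentalGraph.list2 V

/-- The family `𝒢₃`. -/
def family3 (V : Type*) : Set (SimpleGraph V) :=
  bisubdivisionFamily FundamentalGraph.list3 V ∪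
    quadBisubdivisionFamily FundamentalGraph.list3' V

/-! Both numbers depend only on the set system of perfect matchings: the global forcing number is
the least size of a set meeting every symmetric difference of two members, and the anti-forcing
number of `M` is the least size of a set meeting every difference `N \ M`. Accordingly
`ForcingNumbersEq` speaks of abstract set systems and says that a single `g` serves for both. It is
verified for the finitely many fundamental graphs and carried through the two constructions.

Bisubdivision: a perfect matching alternates along an odd path replacing `e`, so each edge of the
path behaves either like `e` or like its complement. Global forcing does not notice complements, but
forbidding an edge of the second kind amounts to prescribing `e`. The lower bound for anti-forcing
is therefore required even against sets that may prescribe elements of `M ∩ R`, where `R` is the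
replaceable set. With this strengthening the value survives (`ForcingNumbersEq.of_bijection`,
`ForcingNumbersEq.bisubdivision`).

Quadrilateral insertion: on a quadrilateral inserted into `e`, the matching is determined if `e ∈
M`, and otherwise there is a free choice between its two pairs of opposite edges. One more edge per
quadrilateral thus suffices for both numbers. Conversely, at a member `M₀` disjoint from the strong
set `T` all choices are free, so a forcing set must spend a separate edge on each quadrilateral. If
the choices are fixed so that these edges carry no information about `M`, the remaining edges
project to a forcing set of the original system (`QuadrilateralSystem.forcingNumbersEq`). This is
why the maximum has to be attained at a member avoiding `T`.

For the fundamental graphs, perfect matchings are enumerated and hitting sets are searched by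
branching, and the kernel evaluates the result. -/

/-! ## Set systems -/

/-- The edge sets of the perfect matchings of `G`. -/
def matchingSets {V : Type*} (G : SimpleGraph V) : Set (Set (Sym2 V)) :=
  {M | M ⊆ G.edgeSet ∧ ∀ v, ∃! e, e ∈ M ∧ v ∈ e}

/-- `g` is both the global forcing number and the largest anti-forcing number of the set system
`𝓜` on the ground set `E`. The latter is attained at a member disjoint from `T`, even if an
anti-forcing set of a member `M` may also prescribe elements of `M ∩ R`. -/
structure ForcingNumbersEq {α : Type*} (E : Set α) (𝓜 : Set (Set α)) (R T : Set α) (g : ℕ) :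
    Prop where
  subset : ∀ M ∈ 𝓜, M ⊆ E
  exists_forcing : ∃ S : Finset α, (S : Set α) ⊆ E ∧ S.card ≤ g ∧
    ∀ M ∈ 𝓜, ∀ N ∈ 𝓜, (∀ e ∈ S, e ∈ M ↔ e ∈ N) → M = N
  le_forcing : ∀ S : Finset α, (S : Set α) ⊆ E →
    (∀ M ∈ 𝓜, ∀ N ∈ 𝓜, (∀ e ∈ S, e ∈ M ↔ e ∈ N) → M = N) → g ≤ S.card
  exists_antiForcing : ∀ M ∈ 𝓜, ∃ S : Finset α, (S : Set α) ⊆ E \ M ∧ S.card ≤ g ∧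
    ∀ N ∈ 𝓜, (∀ e ∈ S, e ∉ N) → N = M
  le_antiForcing : ∃ M ∈ 𝓜, (∀ e ∈ T, e ∉ M) ∧ ∀ S : Finset α, (S : Set α) ⊆ E →
    (∀ e ∈ S, e ∈ M → e ∈ R) → (∀ N ∈ 𝓜, (∀ e ∈ S, e ∈ M ↔ e ∈ N) → N = M) → g ≤ S.card

/-- Transfer of forcing numbers along a bijection of set systems which matches elements up to
complementation, the latter only for elements of `R`. -/
theorem ForcingNumbersEq.of_bijection {α β : Type*} [Nonempty α] [Nonempty β] {E : Set α} {𝓜 : Set (Set α)} {R T : Set α}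
    {g : ℕ} (hg : ForcingNumbersEq E 𝓜 R T g) {E' : Set β} {𝓜' : Set (Set β)} {R' T' : Set β}
    (φ : Set α → Set β) (hsub : ∀ N ∈ 𝓜', N ⊆ E') (hφ : ∀ M ∈ 𝓜, φ M ∈ 𝓜')
    (hsurj : ∀ N ∈ 𝓜', ∃ M ∈ 𝓜, φ M = N)
    (hback : ∀ f ∈ E', ∃ e ∈ E, ((∀ M ∈ 𝓜, f ∈ φ M ↔ e ∈ M) ∧ (f ∈ R' → e ∈ R)) ∨
      (e ∈ R ∧ ∀ M ∈ 𝓜, f ∈ φ M ↔ e ∉ M))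
    (hforth : ∀ e ∈ E, ∃ f ∈ E', ∀ M ∈ 𝓜, f ∈ φ M ↔ e ∈ M)
    (hT : ∀ M ∈ 𝓜, (∀ e ∈ T, e ∉ M) → ∀ f ∈ T', f ∉ φ M) :
    ForcingNumbersEq E' 𝓜' R' T' g := by
  classical
  choose! b hbE hb using hback
  choose! t htE ht using hforth
  have hinj : ∀ M ∈ 𝓜, ∀ N ∈ 𝓜, φ M = φ N → M = N := by
    intro M hM N hN h
    ext e
    constructor
    · intro he
      have := hg.subset M hM he
      rwa [← ht e this N hN, ← h, ht e this M hM]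
    · intro he
      have := hg.subset N hN he
      rwa [← ht e this M hM, h, ht e this N hN]
  have hagree : ∀ f ∈ E', ∀ M ∈ 𝓜, ∀ N ∈ 𝓜, (b f ∈ M ↔ b f ∈ N) → (f ∈ φ M ↔ f ∈ φ N) := by
    intro f hf M hM N hN h
    rcases hb f hf with h' | h'
    · rw [h'.1 M hM, h'.1 N hN, h]
    · rw [h'.2 M hM, h'.2 N hN, h]
  refine ⟨hsub, ?_, ?_, ?_, ?_⟩
  · obtain ⟨S, hSE, hSc, hS⟩ := hg.exists_forcing
    refine ⟨S.image t, ?_, Finset.card_image_le.trans hSc, ?_⟩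
    · intro f hf
      obtain ⟨e, he, rfl⟩ := Finset.mem_image.1 (Finset.mem_coe.1 hf)
      exact htE e (hSE he)
    · intro M' hM' N' hN' h
      obtain ⟨M, hM, rfl⟩ := hsurj M' hM'
      obtain ⟨N, hN, rfl⟩ := hsurj N' hN'
      congr 1
      refine hS M hM N hN fun e he => ?_
      rw [← ht e (hSE he) M hM, ← ht e (hSE he) N hN]
      exact h _ (Finset.mem_image_of_mem t he)
  · intro S hSE hS
    refine (hg.le_forcing (S.image b) ?_ ?_).trans Finset.card_image_le
    · intro e he
      obtain ⟨f, hf, rfl⟩ := Finset.mem_image.1 (Finset.mem_coe.1 he)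
      exact hbE f (hSE hf)
    · intro M hM N hN h
      refine hinj M hM N hN (hS _ (hφ M hM) _ (hφ N hN) fun f hf => ?_)
      exact hagree f (hSE hf) M hM N hN (h _ (Finset.mem_image_of_mem b hf))
  · intro M' hM'
    obtain ⟨M, hM, rfl⟩ := hsurj M' hM'
    obtain ⟨S, hSE, hSc, hS⟩ := hg.exists_antiForcing M hM
    refine ⟨S.image t, ?_, Finset.card_image_le.trans hSc, ?_⟩
    · intro f hf
      obtain ⟨e, he, rfl⟩ := Finset.mem_image.1 (Finset.mem_coe.1 hf)
      refine ⟨htE e (hSE he).1, ?_⟩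
      rw [ht e (hSE he).1 M hM]
      exact (hSE he).2
    · intro N' hN' h
      obtain ⟨N, hN, rfl⟩ := hsurj N' hN'
      congr 1
      refine hS N hN fun e he => ?_
      rw [← ht e (hSE he).1 N hN]
      exact h _ (Finset.mem_image_of_mem t he)
  · obtain ⟨M, hM, hMT, hmin⟩ := hg.le_antiForcing
    refine ⟨φ M, hφ M hM, hT M hM hMT, fun S hSE hSR hS => ?_⟩
    refine (hmin (S.image b) ?_ ?_ ?_).trans Finset.card_image_le
    · intro e he
      obtain ⟨f, hf, rfl⟩ := Finset.mem_image.1 (Finset.mem_coe.1 he)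
      exact hbE f (hSE hf)
    · intro e he heM
      obtain ⟨f, hf, rfl⟩ := Finset.mem_image.1 he
      -- If `f` behaves like `b f`, then `f ∈ φ M` lies in `R'` and so `b f ∈ R`; if it behaves like
      -- the complement, forbidding `f` prescribes `b f`, which is allowed because `b f ∈ R`.
      rcases hb f (hSE hf) with h' | h'
      · exact h'.2 (hSR f hf ((h'.1 M hM).2 heM))
      · exact h'.1
    · intro N hN h
      refine hinj N hN M hM (hS _ (hφ N hN) fun f hf => ?_)
      exact hagree f (hSE hf) M hM N hN (h _ (Finset.mem_image_of_mem b hf))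

/-- The combinatorial effect of inserting quadrilaterals into edges in `T`: a member of the new
set system `𝓜'` is given by a member `M` of `𝓜` and a subset `X` of the set `C` of added chords;
the quadrilateral at `c ∈ C` sits on the edge `o c`. -/
structure QuadrilateralSystem {α β : Type*} (E : Set α) (𝓜 : Set (Set α)) (R T : Set α)
    (E' : Set β) (𝓜' : Set (Set β)) (R' : Set β) (C : Finset β) (o : β → α)
    (ψ : Set α → Set β → Set β) : Prop where
  subset : ∀ N ∈ 𝓜', N ⊆ E'
  chord_mem : (C : Set β) ⊆ E'
  chord_notMem : ∀ c ∈ C, c ∉ R'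
  owner_mem : ∀ c ∈ C, o c ∈ E
  owner_mem_strong : ∀ c ∈ C, o c ∈ T
  map_mem : ∀ M ∈ 𝓜, ∀ X, ψ M X ∈ 𝓜'
  surj : ∀ N ∈ 𝓜', ∃ M ∈ 𝓜, ∃ X, ψ M X = N
  mem_chord : ∀ c ∈ C, ∀ M ∈ 𝓜, ∀ X, c ∈ ψ M X ↔ o c ∉ M ∧ c ∈ X
  forth : ∀ e ∈ E, ∃ f ∈ E', ∀ M ∈ 𝓜, ∀ X, f ∈ ψ M X ↔ e ∈ M
  side : ∀ c ∈ C, ∃ f ∈ E', ∀ M ∈ 𝓜, ∀ X, f ∈ ψ M X ↔ o c ∉ M ∧ c ∉ X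
  back : ∀ f ∈ E', (∃ e ∈ E, (∀ M ∈ 𝓜, ∀ X, f ∈ ψ M X ↔ e ∈ M) ∧ (f ∈ R' → e ∈ R)) ∨
    ∃ c ∈ C, f = c ∨ (∀ M ∈ 𝓜, ∀ X, f ∈ ψ M X ↔ o c ∉ M ∧ c ∉ X) ∨
      (∀ M ∈ 𝓜, ∀ X, f ∈ ψ M X ↔ o c ∈ M ∨ c ∈ X)

/-! ### Forcing numbers under quadrilateral insertion, for abstract set systems -/

namespace QuadrilateralSystem

variable {α β : Type*} {E : Set α} {𝓜 : Set (Set α)} {R T : Set α} {E' : Set β}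
  {𝓜' : Set (Set β)} {R' : Set β} {C : Finset β} {o : β → α} {ψ : Set α → Set β → Set β}

theorem inj (hQ : QuadrilateralSystem E 𝓜 R T E' 𝓜' R' C o ψ) (hE : ∀ M ∈ 𝓜, M ⊆ E)
    {M N : Set α} (hM : M ∈ 𝓜) (hN : N ∈ 𝓜) {X Y : Set β} (h : ψ M X = ψ N Y) : M = N := by
  ext e
  constructor
  · intro he
    obtain ⟨f, -, hf⟩ := hQ.forth e (hE M hM he)
    rwa [← hf N hN Y, ← h, hf M hM]
  · intro he
    obtain ⟨f, -, hf⟩ := hQ.forth e (hE N hN he)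
    rwa [← hf M hM X, h, hf N hN]

/-- At a quadrilateral whose owner lies in `M` nothing is left to choose, so only the chords with
owner outside `M` matter. -/
theorem congr_chords (hQ : QuadrilateralSystem E 𝓜 R T E' 𝓜' R' C o ψ) {M : Set α} (hM : M ∈ 𝓜)
    {X Y : Set β} (h : ∀ c ∈ C, o c ∉ M → (c ∈ X ↔ c ∈ Y)) : ψ M X = ψ M Y := by
  have key : ∀ f ∈ E', f ∈ ψ M X ↔ f ∈ ψ M Y := by
    intro f hf
    rcases hQ.back f hf with ⟨e, -, he, -⟩ | ⟨c, hc, rfl | hc' | hc'⟩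
    · rw [he M hM, he M hM]
    · rw [hQ.mem_chord f hc M hM, hQ.mem_chord f hc M hM]
      have := h f hc; tauto
    · rw [hc' M hM, hc' M hM]
      have := h c hc; tauto
    · rw [hc' M hM, hc' M hM]
      have := h c hc; tauto
  ext f
  exact ⟨fun hf => (key f (hQ.subset _ (hQ.map_mem M hM X) hf)).1 hf,
    fun hf => (key f (hQ.subset _ (hQ.map_mem M hM Y) hf)).2 hf⟩

/-- `f` is an edge of the quadrilateral at `c`. -/
def Label (𝓜 : Set (Set α)) (o : β → α) (ψ : Set α → Set β → Set β) (f c : β) : Prop :=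
  (f = c ∧ ∀ M ∈ 𝓜, ∀ X, f ∈ ψ M X ↔ o c ∉ M ∧ c ∈ X) ∨
    (∀ M ∈ 𝓜, ∀ X, f ∈ ψ M X ↔ o c ∉ M ∧ c ∉ X) ∨ (∀ M ∈ 𝓜, ∀ X, f ∈ ψ M X ↔ o c ∈ M ∨ c ∈ X)

/-- At a member containing neither owner, membership of `f` as a function of `X` is a single
coordinate or its negation, and such a function determines the coordinate. Hence quadrilaterals with
free choices cannot share a distinguishing edge. -/
theorem Label.unique {f c c' : β} (h : Label 𝓜 o ψ f c) (h' : Label 𝓜 o ψ f c') {M : Set α}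
    (hM : M ∈ 𝓜) (hc : o c ∉ M) (hc' : o c' ∉ M) : c = c' := by
  have key : ∀ d, Label 𝓜 o ψ f d → o d ∉ M →
      (∀ X, f ∈ ψ M X ↔ d ∈ X) ∨ (∀ X, f ∈ ψ M X ↔ d ∉ X) := by
    rintro d (⟨-, hd⟩ | hd | hd) hdM
    · exact .inl fun X => by rw [hd M hM]; tauto
    · exact .inr fun X => by rw [hd M hM]; tauto
    · exact .inl fun X => by rw [hd M hM]; tauto
  rcases key c h hc with h1 | h1 <;> rcases key c' h' hc' with h2 | h2
  · have := (h1 {c}).symm.trans (h2 {c}); simp at this; exact this.symm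
  · have h3 := (h1 Set.univ).symm.trans (h2 Set.univ); simp at h3
  · have h3 := (h1 Set.univ).symm.trans (h2 Set.univ); simp at h3
  · have := (h1 {c}).symm.trans (h2 {c}); simp at this; exact this.symm

/-- Two members that differ only in their chord set at `c` are told apart by an edge of the
quadrilateral at `c` only. -/
theorem label_of_ne (hQ : QuadrilateralSystem E 𝓜 R T E' 𝓜' R' C o ψ) {M : Set α} (hM : M ∈ 𝓜)
    {f c : β} (hf : f ∈ E') {X Y : Set β} (hXY : ∀ d, d ≠ c → (d ∈ X ↔ d ∈ Y))
    (h : ¬ (f ∈ ψ M X ↔ f ∈ ψ M Y)) : Label 𝓜 o ψ f c := by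
  rcases hQ.back f hf with ⟨e, -, he, -⟩ | ⟨d, hd, hd'⟩
  · exact absurd (by rw [he M hM, he M hM]) h
  · have hl : Label 𝓜 o ψ f d := by
      rcases hd' with rfl | h' | h'
      · exact .inl ⟨rfl, hQ.mem_chord f hd⟩
      · exact .inr (.inl h')
      · exact .inr (.inr h')
    by_cases hdc : d = c
    · exact hdc ▸ hl
    · refine absurd ?_ h
      rcases hl with ⟨-, h'⟩ | h' | h' <;> rw [h' M hM, h' M hM, hXY d hdc]

/-- The edges `φ c` are the ones spent on the quadrilaterals; they are distinct by `Label.unique`.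
The condition on `X` makes membership of `φ c` in `ψ M X` the same for all `M`: a chord is switched
off, and otherwise the chord is switched on, which excludes its two neighbours and includes its
opposite edge. So the `φ c` can be dropped, and every other edge is replaced by the original edge
governing it. The last clause tracks which original edges may end up prescribed. -/
theorem exists_reduced [Nonempty α] (hQ : QuadrilateralSystem E 𝓜 R T E' 𝓜' R' C o ψ) {M₀ : Set α}
    (hM₀ : M₀ ∈ 𝓜) (hT : ∀ e ∈ T, e ∉ M₀) {S : Finset β} (hS : (S : Set β) ⊆ E') (φ : β → β)
    (hφS : ∀ c ∈ C, φ c ∈ S) (hφ : ∀ c ∈ C, Label 𝓜 o ψ (φ c) c) {X : Set β}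
    (hX : ∀ c ∈ C, c ∈ X ↔ φ c ≠ c) :
    ∃ S' : Finset α, (S' : Set α) ⊆ E ∧ S'.card + C.card ≤ S.card ∧
      (∀ M ∈ 𝓜, ∀ N ∈ 𝓜, (∀ e ∈ S', e ∈ M ↔ e ∈ N) → ∀ f ∈ S, f ∈ ψ M X ↔ f ∈ ψ N X) ∧
      ∀ e ∈ S', e ∈ T ∨ ∃ f ∈ S, (∀ M ∈ 𝓜, ∀ X, f ∈ ψ M X ↔ e ∈ M) ∧ (f ∈ R' → e ∈ R) := by
  classical
  have hb : ∀ f ∈ E', ∃ e ∈ E, (∀ M ∈ 𝓜, ∀ N ∈ 𝓜, (e ∈ M ↔ e ∈ N) → (f ∈ ψ M X ↔ f ∈ ψ N X)) ∧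
      (e ∈ T ∨ (∀ M ∈ 𝓜, ∀ X, f ∈ ψ M X ↔ e ∈ M) ∧ (f ∈ R' → e ∈ R)) := by
    intro f hf
    rcases hQ.back f hf with ⟨e, he, he', heR⟩ | ⟨c, hc, hc'⟩
    · exact ⟨e, he, fun M hM N hN h => by rw [he' M hM, he' N hN, h], .inr ⟨he', heR⟩⟩
    · refine ⟨o c, hQ.owner_mem c hc, fun M hM N hN h => ?_, .inl (hQ.owner_mem_strong c hc)⟩
      rcases hc' with rfl | h' | h'
      · rw [hQ.mem_chord f hc M hM, hQ.mem_chord f hc N hN, h]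
      · rw [h' M hM, h' N hN, h]
      · rw [h' M hM, h' N hN, h]
  choose! b hbE hb hbT using hb
  have hoM : ∀ c ∈ C, o c ∉ M₀ := fun c hc => hT _ (hQ.owner_mem_strong c hc)
  have hinj : Set.InjOn φ C := fun c hc d hd h =>
    (hφ c hc).unique (h ▸ hφ d hd) hM₀ (hoM c hc) (hoM d hd)
  refine ⟨(S \ C.image φ).image b, ?_, ?_, ?_, ?_⟩
  · intro e he
    obtain ⟨f, hf, rfl⟩ := Finset.mem_image.1 (Finset.mem_coe.1 he)
    exact hbE f (hS (Finset.mem_sdiff.1 hf).1)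
  · have h1 : (C.image φ).card = C.card := Finset.card_image_of_injOn hinj
    have h2 : C.image φ ⊆ S := by
      intro f hf
      obtain ⟨c, hc, rfl⟩ := Finset.mem_image.1 hf
      exact hφS c hc
    have h3 := Finset.card_sdiff_add_card_eq_card h2
    have h4 : ((S \ C.image φ).image b).card ≤ (S \ C.image φ).card := Finset.card_image_le
    omega
  · intro M hM N hN h f hf
    by_cases hfC : f ∈ C.image φ
    · obtain ⟨c, hc, rfl⟩ := Finset.mem_image.1 hfC
      have hXc := hX c hc
      rcases hφ c hc with ⟨h0, h'⟩ | h' | h'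
      · rw [h' M hM, h' N hN]; tauto
      -- The chord itself cannot follow this rule: the member `ψ M₀ {c}` contains `c`.
      · have : φ c ≠ c := by
          intro h0
          have h1 := h' M₀ hM₀ {c}
          rw [h0, hQ.mem_chord c hc M₀ hM₀] at h1
          have := hoM c hc
          simp_all
        rw [h' M hM, h' N hN]; tauto
      · by_cases h0 : φ c = c
        · rw [h0, hQ.mem_chord c hc M hM, hQ.mem_chord c hc N hN]; tauto
        · rw [h' M hM, h' N hN]; tauto
    · exact hb f (hS hf) M hM N hN
        (h _ (Finset.mem_image_of_mem b (Finset.mem_sdiff.2 ⟨hf, hfC⟩)))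
  · intro e he
    obtain ⟨f, hf, rfl⟩ := Finset.mem_image.1 he
    have hfS := (Finset.mem_sdiff.1 hf).1
    exact (hbT f (hS hfS)).imp_right fun h => ⟨f, hfS, h⟩

theorem forcingNumbersEq [Nonempty α] [Nonempty β] (hQ : QuadrilateralSystem E 𝓜 R T E' 𝓜' R' C o ψ) {g : ℕ}
    (hg : ForcingNumbersEq E 𝓜 R T g) : ForcingNumbersEq E' 𝓜' R' ∅ (g + C.card) := by
  classical
  choose! t htE ht using hQ.forth
  obtain ⟨M₀, hM₀, hM₀T, hmin⟩ := hg.le_antiForcing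
  have hoM : ∀ c ∈ C, o c ∉ M₀ := fun c hc => hM₀T _ (hQ.owner_mem_strong c hc)
  refine ⟨hQ.subset, ?_, ?_, ?_, ?_⟩
  · obtain ⟨S, hSE, hSc, hS⟩ := hg.exists_forcing
    refine ⟨S.image t ∪ C, ?_, ?_, ?_⟩
    · intro f hf
      rcases Finset.mem_union.1 (Finset.mem_coe.1 hf) with hf | hf
      · obtain ⟨e, he, rfl⟩ := Finset.mem_image.1 hf
        exact htE e (hSE he)
      · exact hQ.chord_mem hf
    · have h1 : (S.image t).card ≤ S.card := Finset.card_image_le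
      have h2 := Finset.card_union_le (S.image t) C
      omega
    · intro M' hM' N' hN' h
      obtain ⟨M, hM, X, rfl⟩ := hQ.surj M' hM'
      obtain ⟨N, hN, Y, rfl⟩ := hQ.surj N' hN'
      obtain rfl : M = N := by
        refine hS M hM N hN fun e he => ?_
        rw [← ht e (hSE he) M hM X, ← ht e (hSE he) N hN Y]
        exact h _ (Finset.mem_union_left _ (Finset.mem_image_of_mem t he))
      refine hQ.congr_chords hM fun c hc hcM => ?_
      have := h c (Finset.mem_union_right _ hc)
      rw [hQ.mem_chord c hc M hM, hQ.mem_chord c hc M hM] at this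
      tauto
  · intro S hSE hS
    have hφ : ∀ c ∈ C, ∃ f ∈ S, Label 𝓜 o ψ f c := by
      intro c hc
      by_contra hcon
      push Not at hcon
      -- These two members differ only in the choice at `c`; if `S` had no edge of that
      -- quadrilateral, it could not separate them.
      have h1 : ψ M₀ ∅ = ψ M₀ {c} := by
        refine hS _ (hQ.map_mem _ hM₀ _) _ (hQ.map_mem _ hM₀ _) fun f hf => ?_
        by_contra hne
        refine hcon f hf (hQ.label_of_ne hM₀ (hSE hf) (fun d hd => ?_) hne)
        simp [hd]
      have h2 : c ∈ ψ M₀ {c} := (hQ.mem_chord c hc M₀ hM₀ _).2 ⟨hoM c hc, rfl⟩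
      rw [← h1, hQ.mem_chord c hc M₀ hM₀] at h2
      exact h2.2
    choose! φ hφS hφ using hφ
    obtain ⟨S', hS'E, hcard, hagree, -⟩ := hQ.exists_reduced hM₀ hM₀T hSE φ hφS hφ
      (X := {c | φ c ≠ c}) (fun c _ => Iff.rfl)
    have := hg.le_forcing S' hS'E fun M hM N hN h =>
      hQ.inj hg.subset hM hN (hS _ (hQ.map_mem M hM _) _ (hQ.map_mem N hN _) (hagree M hM N hN h))
    omega
  · intro M' hM'
    obtain ⟨M, hM, X, rfl⟩ := hQ.surj M' hM'
    obtain ⟨S, hSE, hSc, hS⟩ := hg.exists_antiForcing M hM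
    choose! b hbE hb using hQ.side
    -- At each quadrilateral the unused choice is forbidden: the chord if it is not chosen, and an
    -- edge next to it if it is.
    refine ⟨S.image t ∪ C.image fun c => if c ∈ X then b c else c, ?_, ?_, ?_⟩
    · intro f hf
      rcases Finset.mem_union.1 (Finset.mem_coe.1 hf) with hf | hf
      · obtain ⟨e, he, rfl⟩ := Finset.mem_image.1 hf
        refine ⟨htE e (hSE he).1, ?_⟩
        rw [ht e (hSE he).1 M hM]
        exact (hSE he).2
      · obtain ⟨c, hc, rfl⟩ := Finset.mem_image.1 hf
        by_cases hcX : c ∈ X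
        · simp only [hcX, if_true]
          refine ⟨hbE c hc, ?_⟩
          rw [hb c hc M hM]
          tauto
        · simp only [hcX, if_false]
          refine ⟨hQ.chord_mem hc, ?_⟩
          rw [hQ.mem_chord c hc M hM]
          tauto
    · have h1 : (S.image t).card ≤ S.card := Finset.card_image_le
      have h2 : (C.image fun c => if c ∈ X then b c else c).card ≤ C.card := Finset.card_image_le
      have h3 := Finset.card_union_le (S.image t) (C.image fun c => if c ∈ X then b c else c)
      omega
    · intro N' hN' h
      obtain ⟨N, hN, Y, rfl⟩ := hQ.surj N' hN'
      obtain rfl : N = M := by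
        refine hS N hN fun e he => ?_
        rw [← ht e (hSE he).1 N hN Y]
        exact h _ (Finset.mem_union_left _ (Finset.mem_image_of_mem t he))
      refine hQ.congr_chords hM fun c hc hcM => ?_
      have := h _ (Finset.mem_union_right _ (Finset.mem_image_of_mem _ hc))
      by_cases hcX : c ∈ X
      · simp only [hcX, if_true] at this
        rw [hb c hc N hM] at this
        tauto
      · simp only [hcX, if_false] at this
        rw [hQ.mem_chord c hc N hM] at this
        tauto
  -- The extremal member uses every chord. Chords are never subdivided, so they lie outside `R'` and
  -- cannot be prescribed; each quadrilateral therefore costs an edge other than its chord, and `X =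
  -- C` meets the requirement of `exists_reduced`.
  · refine ⟨ψ M₀ C, hQ.map_mem _ hM₀ _, fun _ h => h.elim, fun S hSE hSR hS => ?_⟩
    have hφ : ∀ c ∈ C, ∃ f ∈ S, Label 𝓜 o ψ f c ∧ f ≠ c := by
      intro c hc
      have hcM : c ∈ ψ M₀ C := (hQ.mem_chord c hc M₀ hM₀ _).2 ⟨hoM c hc, hc⟩
      by_contra hcon
      push Not at hcon
      have h1 : ψ M₀ (C \ {c}) = ψ M₀ C := by
        refine hS _ (hQ.map_mem _ hM₀ _) fun f hf => ?_
        by_contra hne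
        have hl := hQ.label_of_ne hM₀ (hSE hf) (c := c) (fun d hd => by simp [hd]) hne
        have := hcon f hf hl
        exact hQ.chord_notMem c hc (hSR c (this ▸ hf) hcM)
      rw [← h1, hQ.mem_chord c hc M₀ hM₀] at hcM
      exact hcM.2.2 rfl
    choose! φ hφS hφ hφc using hφ
    obtain ⟨S', hS'E, hcard, hagree, hS'⟩ := hQ.exists_reduced hM₀ hM₀T hSE φ hφS hφ
      (X := C) (fun c hc => ⟨fun _ => hφc c hc, fun _ => hc⟩)
    have := hmin S' hS'E
      (fun e he heM => by
        rcases hS' e he with h | ⟨f, hf, hfe, hfR⟩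
        · exact absurd heM (hM₀T e h)
        · exact hfR (hSR f hf ((hfe M₀ hM₀ _).2 heM)))
      (fun N hN h => hQ.inj hg.subset hN hM₀ (hS _ (hQ.map_mem N hN _) (hagree M₀ hM₀ N hN h)))
    omega

end QuadrilateralSystem

/-! ## From edge sets to perfect matchings -/

section Matchings

variable {V : Type*} {G : SimpleGraph V}

theorem isPerfectMatching_edgeSet_mem {M : G.Subgraph} (hM : M.IsPerfectMatching) :
    M.edgeSet ∈ matchingSets G := by
  rw [SimpleGraph.Subgraph.isPerfectMatching_iff] at hM
  refine ⟨M.edgeSet_subset, fun v => ?_⟩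
  obtain ⟨w, hw, huniq⟩ := hM v
  refine ⟨s(v, w), ⟨hw, Sym2.mem_mk_left v w⟩, ?_⟩
  rintro e ⟨he, hv⟩
  obtain ⟨x, rfl⟩ := Sym2.mem_iff_exists.1 hv
  rw [huniq x he]

theorem exists_isPerfectMatching_edgeSet_eq {M : Set (Sym2 V)} (hM : M ∈ matchingSets G) :
    ∃ N : G.Subgraph, N.IsPerfectMatching ∧ N.edgeSet = M := by
  let N : G.Subgraph :=
    { verts := Set.univ
      Adj := fun v w => s(v, w) ∈ M
      adj_sub := fun h => hM.1 h
      edge_vert := fun _ => Set.mem_univ _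
      symm := ⟨fun v w h => by rwa [Sym2.eq_swap]⟩ }
  refine ⟨N, ?_, ?_⟩
  · rw [SimpleGraph.Subgraph.isPerfectMatching_iff]
    intro v
    obtain ⟨e, ⟨he, hv⟩, huniq⟩ := hM.2 v
    obtain ⟨w, rfl⟩ := Sym2.mem_iff_exists.1 hv
    refine ⟨w, he, fun x hx => ?_⟩
    have := huniq s(v, x) ⟨hx, Sym2.mem_mk_left v x⟩
    exact Sym2.congr_right.1 this
  · ext e
    induction e using Sym2.ind with
    | _ v w => rfl

theorem eq_of_edgeSet_eq {M N : G.Subgraph} (hM : M.IsPerfectMatching) (hN : N.IsPerfectMatching)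
    (h : M.edgeSet = N.edgeSet) : M = N := by
  refine SimpleGraph.Subgraph.ext ?_ ?_
  · rw [hM.2.verts_eq_univ, hN.2.verts_eq_univ]
  · funext v w
    rw [← SimpleGraph.Subgraph.mem_edgeSet, h, SimpleGraph.Subgraph.mem_edgeSet]

theorem mem_matchingSets_deleteEdges {S M : Set (Sym2 V)} :
    M ∈ matchingSets (G.deleteEdges S) ↔ M ∈ matchingSets G ∧ ∀ e ∈ S, e ∉ M := by
  simp only [matchingSets, Set.mem_ofPred_eq, SimpleGraph.edgeSet_deleteEdges, Set.subset_sdiff,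
    Set.disjoint_right]
  tauto

theorem isAntiForcingSet_iff {M : G.Subgraph} {S : Finset (Sym2 V)} :
    IsAntiForcingSet G M S ↔ (S : Set (Sym2 V)) ⊆ G.edgeSet \ M.edgeSet ∧
      ∀ N ∈ matchingSets G, (∀ e ∈ S, e ∉ N) → N = M.edgeSet := by
  refine and_congr_right fun _ => ⟨fun h N hN hS => ?_, fun h N hN => ?_⟩
  · obtain ⟨N', hN', rfl⟩ := exists_isPerfectMatching_edgeSet_eq
      (mem_matchingSets_deleteEdges.2 ⟨hN, (fun e he => hS e he : ∀ e ∈ (S : Set (Sym2 V)), e ∉ N)⟩)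
    exact h N' hN'
  · have := mem_matchingSets_deleteEdges.1 (isPerfectMatching_edgeSet_mem hN)
    exact h _ this.1 this.2

theorem isGlobalForcingSet_iff {S : Finset (Sym2 V)} :
    IsGlobalForcingSet G S ↔ (S : Set (Sym2 V)) ⊆ G.edgeSet ∧
      ∀ M ∈ matchingSets G, ∀ N ∈ matchingSets G, (∀ e ∈ S, e ∈ M ↔ e ∈ N) → M = N := by
  have key : ∀ A B : Set (Sym2 V), (S : Set (Sym2 V)) ∩ A = (S : Set (Sym2 V)) ∩ B ↔
      ∀ e ∈ S, e ∈ A ↔ e ∈ B := by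
    intro A B
    simp [Set.ext_iff]
  refine and_congr_right fun _ => ⟨fun h M hM N hN hS => ?_, fun h M N hM hN hne hS => ?_⟩
  · obtain ⟨M', hM', rfl⟩ := exists_isPerfectMatching_edgeSet_eq hM
    obtain ⟨N', hN', rfl⟩ := exists_isPerfectMatching_edgeSet_eq hN
    by_contra hne
    exact h M' N' hM' hN' (fun h' => hne (h' ▸ rfl)) ((key _ _).2 hS)
  · exact hne (eq_of_edgeSet_eq hM hN (h _ (isPerfectMatching_edgeSet_mem hM) _
      (isPerfectMatching_edgeSet_mem hN) ((key _ _).1 hS)))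

theorem ForcingNumbersEq.globalForcingNumber_eq {R T : Set (Sym2 V)} {g : ℕ}
    (hg : ForcingNumbersEq G.edgeSet (matchingSets G) R T g) : globalForcingNumber G = g := by
  obtain ⟨S, hSE, hSc, hS⟩ := hg.exists_forcing
  have hS' := isGlobalForcingSet_iff.2 ⟨hSE, hS⟩
  unfold globalForcingNumber
  refine le_antisymm (le_trans (Nat.sInf_le ⟨S, hS', rfl⟩) hSc) (le_csInf ?_ ?_)
  · exact ⟨S.card, S, hS', rfl⟩
  rintro k ⟨S, hS, rfl⟩
  rw [isGlobalForcingSet_iff] at hS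
  exact hg.le_forcing S hS.1 hS.2

theorem ForcingNumbersEq.maxAntiForcingNumber_eq {R T : Set (Sym2 V)} {g : ℕ}
    (hg : ForcingNumbersEq G.edgeSet (matchingSets G) R T g) :
    (∃ M : G.Subgraph, M.IsPerfectMatching) ∧ maxAntiForcingNumber G = g := by
  -- Existence of an anti-forcing set is recorded as well, since the infimum of the empty set would
  -- be the default `0`.
  have hle : ∀ M : G.Subgraph, M.IsPerfectMatching → antiForcingNumber G M ≤ g ∧
      ∃ S : Finset (Sym2 V), IsAntiForcingSet G M S := by
    intro M hM
    obtain ⟨S, hSE, hSc, hS⟩ := hg.exists_antiForcing _ (isPerfectMatching_edgeSet_mem hM)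
    have hS' := isAntiForcingSet_iff.2 ⟨hSE, hS⟩
    exact ⟨le_trans (Nat.sInf_le ⟨S, hS', rfl⟩) hSc, S, hS'⟩
  obtain ⟨M', hM', -, hmin⟩ := hg.le_antiForcing
  obtain ⟨M, hM, rfl⟩ := exists_isPerfectMatching_edgeSet_eq hM'
  unfold maxAntiForcingNumber
  refine ⟨⟨M, hM⟩, le_antisymm (csSup_le ?_ ?_) ?_⟩
  · exact ⟨_, M, hM, rfl⟩
  · rintro k ⟨M, hM, rfl⟩
    exact (hle M hM).1
  · have hge : g ≤ antiForcingNumber G M := by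
      obtain ⟨S, hS⟩ := (hle M hM).2
      unfold antiForcingNumber
      refine le_csInf ?_ ?_
      · exact ⟨S.card, S, hS, rfl⟩
      rintro k ⟨S, hS, rfl⟩
      obtain ⟨hSE, hS⟩ := isAntiForcingSet_iff.1 hS
      -- As `S` avoids `M`, nothing is prescribed, and agreeing with `M` on `S` means avoiding `S`.
      refine hmin S (fun e he => (hSE he).1) (fun e he heM => absurd heM (hSE he).2)
        fun N hN h => hS N hN fun e he heN => (hSE he).2 ((h e he).2 heN)
    refine hge.trans (le_csSup ⟨g, ?_⟩ ⟨M, hM, rfl⟩)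
    rintro k ⟨M, hM, rfl⟩
    exact (hle M hM).1

end Matchings

/-! ## Replacement paths -/

namespace PathReplacement

variable {V W : Type*} {G : SimpleGraph V} {G' : SimpleGraph W} (P : PathReplacement G G')

/-- The number of edges of the path replacing `uv`. -/
def len {u v : V} (h : G.Adj u v) : ℕ := (P.path h).length

/-- The `i`-th vertex of the path replacing `uv`. -/
def vert {u v : V} (h : G.Adj u v) (i : ℕ) : W := (P.path h).getVert i

/-- The `i`-th edge of the path replacing `uv`. -/
def edge {u v : V} (h : G.Adj u v) (i : ℕ) : Sym2 W := s(P.vert h i, P.vert h (i + 1))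

variable {P} {u v a b : V}

theorem len_symm (h : G.Adj u v) : P.len h.symm = P.len h := by
  simp [len, P.path_symm h]

theorem vert_symm (h : G.Adj u v) (i : ℕ) : P.vert h.symm i = P.vert h (P.len h - i) := by
  simp [vert, len, P.path_symm h, SimpleGraph.Walk.getVert_reverse]

theorem edge_symm (h : G.Adj u v) {i j : ℕ} (hi : i + j + 1 = P.len h) :
    P.edge h.symm i = P.edge h j := by
  rw [edge, edge, vert_symm h, vert_symm h, show P.len h - i = j + 1 by omega,
    show P.len h - (i + 1) = j by omega, Sym2.eq_swap]

@[simp] theorem vert_zero (h : G.Adj u v) : P.vert h 0 = P.branch u := by simp [vert]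

@[simp] theorem vert_len (h : G.Adj u v) : P.vert h (P.len h) = P.branch v := by simp [vert, len]

theorem len_pos (h : G.Adj u v) : 0 < P.len h := by
  refine Nat.pos_of_ne_zero fun h0 => h.ne (P.branch.injective ?_)
  rw [← vert_zero h, ← vert_len h, h0]

theorem vert_inj (h : G.Adj u v) {i j : ℕ} (hi : i ≤ P.len h) (hj : j ≤ P.len h)
    (hij : P.vert h i = P.vert h j) : i = j :=
  (P.isPath h).getVert_injOn hi hj hij

theorem vert_mem_support (h : G.Adj u v) (i : ℕ) : P.vert h i ∈ (P.path h).support :=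
  (P.path h).getVert_mem_support i

theorem eq_zero_or_len (h : G.Adj u v) {i : ℕ} (hi : i ≤ P.len h) {x : V}
    (hx : P.branch x = P.vert h i) : (i = 0 ∧ x = u) ∨ (i = P.len h ∧ x = v) := by
  rcases P.branch_mem h x (hx ▸ vert_mem_support h i) with rfl | rfl
  · left
    rw [← vert_zero h] at hx
    exact ⟨(vert_inj h (Nat.zero_le _) hi hx).symm, rfl⟩
  · right
    rw [← vert_len h] at hx
    exact ⟨(vert_inj h le_rfl hi hx).symm, rfl⟩

/-- A common vertex of two replacement paths that is interior to the first one forces the paths to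
agree up to direction. -/
theorem eq_of_vert_eq (h : G.Adj u v) (h' : G.Adj a b) {i j : ℕ} (hi0 : 0 < i) (hi : i < P.len h)
    (hj : j ≤ P.len h') (hij : P.vert h i = P.vert h' j) :
    (a = u ∧ b = v ∧ j = i) ∨ (a = v ∧ b = u ∧ i + j = P.len h) := by
  have hs : s(u, v) = s(a, b) := by
    by_contra hne
    obtain ⟨x, hx⟩ := P.disjoint h h' hne _ (vert_mem_support h i) (hij ▸ vert_mem_support h' j)
    rcases eq_zero_or_len h hi.le hx with h0 | h0 <;> omega
  rcases Sym2.eq_iff.1 hs with ⟨rfl, rfl⟩ | ⟨rfl, rfl⟩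
  · exact .inl ⟨rfl, rfl, (vert_inj h hi.le hj hij).symm⟩
  · refine .inr ⟨rfl, rfl, ?_⟩
    rw [show h' = h.symm from rfl, len_symm h] at hj
    rw [show h' = h.symm from rfl, vert_symm h] at hij
    have := vert_inj h hi.le (Nat.sub_le _ _) hij
    omega

theorem mem_edge {h : G.Adj u v} {i : ℕ} {w : W} :
    w ∈ P.edge h i ↔ w = P.vert h i ∨ w = P.vert h (i + 1) := Sym2.mem_iff

/-- An edge shared by the paths of two different edges would have both ends at branch vertices,
hence join the branch vertices of both pairs, and the two edges would coincide. Within one edge only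
the reversal of its path remains. -/
theorem edge_inj (h : G.Adj u v) (h' : G.Adj a b) {i j : ℕ} (hi : i < P.len h)
    (hj : j < P.len h') (hij : P.edge h i = P.edge h' j) :
    (a = u ∧ b = v ∧ j = i) ∨ (a = v ∧ b = u ∧ i + j + 1 = P.len h) := by
  have hs : s(u, v) = s(a, b) := by
    by_contra hne
    have key : ∀ w ∈ P.edge h i, w ∈ Set.range P.branch := by
      intro w hw
      refine P.disjoint h h' hne w ?_ ?_
      · rcases mem_edge.1 hw with rfl | rfl <;> exact vert_mem_support _ _
      · rw [hij] at hw
        rcases mem_edge.1 hw with rfl | rfl <;> exact vert_mem_support _ _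
    obtain ⟨x, hx⟩ := key _ (mem_edge.2 (.inl rfl))
    obtain ⟨y, hy⟩ := key _ (mem_edge.2 (.inr rfl))
    have hx' : P.branch x ∈ P.edge h' j := hij ▸ hx ▸ mem_edge.2 (.inl rfl)
    have hy' : P.branch y ∈ P.edge h' j := hij ▸ hy ▸ mem_edge.2 (.inr rfl)
    have hxu := eq_zero_or_len h hi.le hx
    have hyv' := eq_zero_or_len h hi hy
    have hxv : x = u := by rcases hxu with h | h <;> first | exact h.2 | omega
    have hyv : y = v := by rcases hyv' with h | h <;> first | exact h.2 | omega
    subst hxv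
    subst hyv
    refine hne (Sym2.eq_iff.2 ?_)
    have hne' := h.ne
    rcases mem_edge.1 hx' with h1 | h1 <;> rcases mem_edge.1 hy' with h2 | h2
    · exact absurd (P.branch.injective (h1.trans h2.symm)) hne'
    · have := eq_zero_or_len h' hj.le h1
      have := eq_zero_or_len h' hj h2
      have := len_pos (P := P) h'
      grind
    · have := eq_zero_or_len h' hj.le h2
      have := eq_zero_or_len h' hj h1
      have := len_pos (P := P) h'
      grind
    · exact absurd (P.branch.injective (h1.trans h2.symm)) hne'
  rcases Sym2.eq_iff.1 hs with ⟨rfl, rfl⟩ | ⟨rfl, rfl⟩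
  · refine .inl ⟨rfl, rfl, ?_⟩
    rcases Sym2.eq_iff.1 hij with ⟨h1, -⟩ | ⟨h1, h2⟩
    · exact (vert_inj h hi.le hj.le h1).symm
    · have := vert_inj h hi.le hj h1
      have := vert_inj h hi hj.le h2
      omega
  · refine .inr ⟨rfl, rfl, ?_⟩
    rw [show h' = h.symm from rfl, len_symm h] at hj
    rw [show h' = h.symm from rfl, edge_symm h (j := P.len h - j - 1) (by omega)] at hij
    rcases Sym2.eq_iff.1 hij with ⟨h1, -⟩ | ⟨h1, h2⟩
    · have := vert_inj h hi.le (by omega) h1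
      omega
    · have := vert_inj h hi.le (by omega) h1
      have := vert_inj h hi (by omega) h2
      omega

theorem edge_ne_edge (h : G.Adj u v) {i : ℕ} (hi0 : 0 < i) (hi : i < P.len h) :
    P.edge h (i - 1) ≠ P.edge h i := by
  intro h'
  have := edge_inj h h (by omega) hi h'
  have := h.ne
  grind

theorem mem_edges_path {h : G.Adj u v} {f : Sym2 W} :
    f ∈ (P.path h).edges ↔ ∃ i < P.len h, f = P.edge h i := by
  rw [SimpleGraph.Walk.edges_eq_map_darts, List.mem_map]
  constructor
  · rintro ⟨d, hd, rfl⟩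
    obtain ⟨i, hi, rfl⟩ := List.mem_iff_getElem.1 hd
    refine ⟨i, by simpa [len] using hi, ?_⟩
    rw [SimpleGraph.Walk.darts_getElem_eq_getVert]
    rfl
  · rintro ⟨i, hi, rfl⟩
    have hi' : i < (P.path h).darts.length := by simpa [len] using hi
    refine ⟨_, List.getElem_mem hi', ?_⟩
    rw [SimpleGraph.Walk.darts_getElem_eq_getVert]
    rfl

theorem mem_pathEdges {S : Set (Sym2 V)} {f : Sym2 W} :
    f ∈ P.pathEdges S ↔ ∃ (u v : V) (h : G.Adj u v), s(u, v) ∈ S ∧ ∃ i < P.len h, f = P.edge h i := by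
  simp only [pathEdges, Set.mem_ofPred_eq, mem_edges_path]

theorem edge_mem_pathEdges {S : Set (Sym2 V)} (h : G.Adj u v) {i : ℕ} (hi : i < P.len h) :
    P.edge h i ∈ P.pathEdges S ↔ s(u, v) ∈ S := by
  rw [mem_pathEdges]
  constructor
  · rintro ⟨a, b, h', hS, j, hj, hij⟩
    rcases edge_inj h h' hi hj hij with ⟨rfl, rfl, -⟩ | ⟨rfl, rfl, -⟩
    · exact hS
    · rwa [Sym2.eq_swap]
  · exact fun hS => ⟨u, v, h, hS, i, hi, rfl⟩

/-- The edges of `G'` at a branch vertex are the first edges of the paths leaving it. -/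
theorem branch_mem_edge (h : G.Adj a b) {i : ℕ} (hi : i < P.len h)
    (hv : P.branch v ∈ P.edge h i) :
    ∃ (w : V) (h' : G.Adj v w), s(v, w) = s(a, b) ∧ P.edge h i = P.edge h' 0 := by
  rcases mem_edge.1 hv with h1 | h1
  · rcases eq_zero_or_len h hi.le h1 with ⟨rfl, rfl⟩ | h0
    · exact ⟨b, h, rfl, rfl⟩
    · omega
  · rcases eq_zero_or_len h hi h1 with h0 | ⟨h0, rfl⟩
    · omega
    · exact ⟨a, h.symm, Sym2.eq_swap, (edge_symm h (by omega)).symm⟩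

/-- The edges of the paths at an interior vertex. -/
theorem vert_mem_edge (h : G.Adj u v) (h' : G.Adj a b) {i j : ℕ} (hi0 : 0 < i) (hi : i < P.len h)
    (hj : j < P.len h') (hv : P.vert h i ∈ P.edge h' j) :
    P.edge h' j = P.edge h (i - 1) ∨ P.edge h' j = P.edge h i := by
  rcases mem_edge.1 hv with h1 | h1
  · rcases eq_of_vert_eq h h' hi0 hi hj.le h1 with ⟨rfl, rfl, rfl⟩ | ⟨rfl, rfl, h2⟩
    · exact .inr rfl
    · exact .inl (edge_symm h (by omega))
  · rcases eq_of_vert_eq h h' hi0 hi hj h1 with ⟨rfl, rfl, rfl⟩ | ⟨rfl, rfl, h2⟩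
    · exact .inl rfl
    · exact .inr (edge_symm h (by omega))

theorem vert_mem_edge_pred (h : G.Adj u v) {i : ℕ} (hi0 : 0 < i) :
    P.vert h i ∈ P.edge h (i - 1) := by
  rw [mem_edge, Nat.sub_add_cancel hi0]
  exact .inr rfl

theorem vert_mem_edge_self (h : G.Adj u v) (i : ℕ) : P.vert h i ∈ P.edge h i :=
  mem_edge.2 (.inl rfl)

variable (P) in
theorem vertex_cases (w : W) :
    (∃ v, w = P.branch v) ∨ ∃ (u v : V) (h : G.Adj u v) (i : ℕ), 0 < i ∧ i < P.len h ∧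
      w = P.vert h i := by
  rcases P.cover w with ⟨v, rfl⟩ | ⟨u, v, h, hw⟩
  · exact .inl ⟨v, rfl⟩
  · obtain ⟨i, rfl, hi⟩ := SimpleGraph.Walk.mem_support_iff_exists_getVert.1 hw
    change i ≤ P.len h at hi
    rcases Nat.eq_zero_or_pos i with rfl | hi0
    · exact .inl ⟨u, vert_zero h⟩
    · rcases hi.eq_or_lt with rfl | hi
      · exact .inl ⟨v, vert_len h⟩
      · exact .inr ⟨u, v, h, i, hi0, hi, rfl⟩

/-- The edges on the replacement paths singled out by a condition on the position in the path. -/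
def pathSet (P : PathReplacement G G') (q : ∀ {u v : V}, G.Adj u v → ℕ → Prop) : Set (Sym2 W) :=
  {f | ∃ (u v : V) (h : G.Adj u v) (i : ℕ), i < P.len h ∧ f = P.edge h i ∧ q h i}

theorem edge_mem_pathSet {q : ∀ {u v : V}, G.Adj u v → ℕ → Prop}
    (hq : ∀ {u v : V} (h : G.Adj u v) (i j : ℕ), i + j + 1 = P.len h → q h.symm i → q h j)
    (h : G.Adj u v) {i : ℕ} (hi : i < P.len h) : P.edge h i ∈ P.pathSet q ↔ q h i := by
  constructor
  · rintro ⟨a, b, h', j, hj, hij, hqj⟩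
    rcases edge_inj h h' hi hj hij with ⟨rfl, rfl, rfl⟩ | ⟨rfl, rfl, h0⟩
    · exact hqj
    · exact hq h j i (by omega) hqj
  · exact fun h0 => ⟨u, v, h, i, hi, rfl, h0⟩

/-- Taking first edges of paths identifies the star of `v` in `G` with the path edges at its branch
vertex. `hN` admits chords in `N`, as long as they miss the branch vertices. -/
theorem existsUnique_branch {N : Set (Sym2 W)} {M : Set (Sym2 V)} (hM : M ⊆ G.edgeSet)
    (hN : ∀ f ∈ N, ∀ v, P.branch v ∈ f → f ∈ P.pathEdges Set.univ)
    (hNM : ∀ {u v : V} (h : G.Adj u v), P.edge h 0 ∈ N ↔ s(u, v) ∈ M) (v : V) :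
    (∃! f, f ∈ N ∧ P.branch v ∈ f) ↔ ∃! e, e ∈ M ∧ v ∈ e := by
  have hstar : ∀ f ∈ N, P.branch v ∈ f → ∃ (w : V) (h : G.Adj v w), f = P.edge h 0 := by
    intro f hf hv
    obtain ⟨a, b, h, -, i, hi, rfl⟩ := mem_pathEdges.1 (hN f hf v hv)
    obtain ⟨w, h', -, h0⟩ := branch_mem_edge h hi hv
    exact ⟨w, h', h0⟩
  have hmem : ∀ {w : V} (h : G.Adj v w), P.branch v ∈ P.edge h 0 := fun h =>
    mem_edge.2 (.inl (vert_zero h).symm)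
  constructor
  · rintro ⟨f, ⟨hf, hv⟩, huniq⟩
    obtain ⟨w, h, rfl⟩ := hstar f hf hv
    refine ⟨s(v, w), ⟨(hNM h).1 hf, Sym2.mem_mk_left v w⟩, ?_⟩
    rintro e ⟨he, hve⟩
    obtain ⟨x, rfl⟩ := Sym2.mem_iff_exists.1 hve
    have hx : G.Adj v x := hM he
    have := huniq _ ⟨(hNM hx).2 he, hmem hx⟩
    rcases edge_inj h hx (len_pos h) (len_pos hx) this.symm with ⟨-, rfl, -⟩ | ⟨h1, -, -⟩
    · rfl
    · exact absurd h1 h.ne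
  · rintro ⟨e, ⟨he, hve⟩, huniq⟩
    obtain ⟨x, rfl⟩ := Sym2.mem_iff_exists.1 hve
    have hx : G.Adj v x := hM he
    refine ⟨P.edge hx 0, ⟨(hNM hx).2 he, hmem hx⟩, ?_⟩
    rintro f ⟨hf, hv⟩
    obtain ⟨w, h, rfl⟩ := hstar f hf hv
    obtain rfl : w = x :=
      Sym2.congr_right.1 (huniq s(v, w) ⟨(hNM h).1 hf, Sym2.mem_mk_left v w⟩)
    rfl

/-- Only two path edges meet at an interior vertex, so being matched once means alternating there.
`hN` concerns this one vertex, so the statement also serves for the middle vertices of a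
quadrilateral. -/
theorem existsUnique_interior {N : Set (Sym2 W)} (h : G.Adj u v) {i : ℕ} (hi0 : 0 < i)
    (hi : i < P.len h) (hN : ∀ f ∈ N, P.vert h i ∈ f → f ∈ P.pathEdges Set.univ) :
    (∃! f, f ∈ N ∧ P.vert h i ∈ f) ↔ (P.edge h i ∈ N ↔ P.edge h (i - 1) ∉ N) := by
  have hstar : ∀ f ∈ N, P.vert h i ∈ f → f = P.edge h (i - 1) ∨ f = P.edge h i := by
    intro f hf hv
    obtain ⟨a, b, h', -, j, hj, rfl⟩ := mem_pathEdges.1 (hN f hf hv)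
    exact vert_mem_edge h h' hi0 hi hj hv
  have h1 := vert_mem_edge_pred (P := P) h hi0
  have h2 := vert_mem_edge_self (P := P) h i
  have hne := edge_ne_edge h hi0 hi
  constructor
  · rintro ⟨f, ⟨hf, hv⟩, huniq⟩
    have := huniq (P.edge h (i - 1))
    have := huniq (P.edge h i)
    have := hstar f hf hv
    grind
  · intro h0
    by_cases h3 : P.edge h i ∈ N
    · refine ⟨_, ⟨h3, h2⟩, fun f hf => ?_⟩
      rcases hstar f hf.1 hf.2 with rfl | rfl
      · exact absurd hf.1 (h0.1 h3)
      · rfl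
    · refine ⟨P.edge h (i - 1), ⟨by tauto, h1⟩, fun f hf => ?_⟩
      rcases hstar f hf.1 hf.2 with rfl | rfl
      · rfl
      · exact absurd hf.1 h3

end PathReplacement

/-! ## Bisubdivisions -/

section Bisubdivision

open PathReplacement

variable {V W : Type*} {G : SimpleGraph V} {G' : SimpleGraph W}

/-- Perfect matchings of `G` and `G'` correspond by alternation along the paths, so `of_bijection`
applies: even positions copy the replaced edge and odd positions copy its complement. -/
theorem ForcingNumbersEq.bisubdivision [Nonempty V] {R T : Set (Sym2 V)} {g : ℕ}
    (hg : ForcingNumbersEq G.edgeSet (matchingSets G) R T g) (hG : IsBisubdivision G R G') :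
    ForcingNumbersEq G'.edgeSet (matchingSets G') ∅ ∅ g := by
  obtain ⟨P, hodd, hone, hE⟩ := hG
  replace hodd : ∀ {u v : V} (h : G.Adj u v), Odd (P.len h) := hodd
  replace hone : ∀ {u v : V} (h : G.Adj u v), s(u, v) ∉ R → P.len h = 1 := hone
  have hpath : ∀ f ∈ G'.edgeSet, f ∈ P.pathEdges Set.univ := fun f hf => hE ▸ hf
  -- Odd length makes this pattern independent of the direction in which the path is read.
  let φ : Set (Sym2 V) → Set (Sym2 W) := fun M =>
    P.pathSet fun {u v} _ i => Even i ↔ s(u, v) ∈ M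
  have hφ : ∀ (M : Set (Sym2 V)) {u v : V} (h : G.Adj u v) {i : ℕ}, i < P.len h →
      (P.edge h i ∈ φ M ↔ (Even i ↔ s(u, v) ∈ M)) := by
    intro M u v h i hi
    refine edge_mem_pathSet (fun {u v} h i j hij => ?_) h hi
    have h1 := hodd h
    rw [← hij] at h1
    rw [Sym2.eq_swap]
    have : Even i ↔ Even j := by
      rw [Nat.odd_add_one, Nat.not_odd_iff_even, Nat.even_add] at h1
      exact h1
    rw [this]
    exact id
  have hφE : ∀ M, φ M ⊆ G'.edgeSet := by
    rintro M f ⟨u, v, h, i, hi, rfl, -⟩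
    rw [hE]
    exact mem_pathEdges.2 ⟨u, v, h, trivial, i, hi, rfl⟩
  have hφ0 : ∀ (M : Set (Sym2 V)) {u v : V} (h : G.Adj u v),
      P.edge h 0 ∈ φ M ↔ s(u, v) ∈ M := by
    intro M u v h
    rw [hφ M h (len_pos h)]
    simp
  have : Nonempty W := ⟨P.branch (Classical.arbitrary V)⟩
  have : Nonempty (Sym2 V) := ⟨s(Classical.arbitrary V, Classical.arbitrary V)⟩
  have : Nonempty (Sym2 W) := ⟨s(Classical.arbitrary W, Classical.arbitrary W)⟩
  refine hg.of_bijection φ (fun N hN => hN.1) ?_ ?_ ?_ ?_ (fun _ _ _ _ h => h.elim)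
  · intro M hM
    refine ⟨hφE M, fun w => ?_⟩
    rcases P.vertex_cases w with ⟨v, rfl⟩ | ⟨u, v, h, i, hi0, hi, rfl⟩
    · rw [existsUnique_branch hM.1 (fun f hf _ _ => hpath f (hφE M hf)) (hφ0 M)]
      exact hM.2 v
    · rw [existsUnique_interior h hi0 hi (fun f hf _ => hpath f (hφE M hf)), hφ M h hi,
        hφ M h (by omega)]
      obtain ⟨j, rfl⟩ := Nat.exists_eq_add_of_lt hi0
      simp only [zero_add, Nat.add_sub_cancel, Nat.even_add_one]
      tauto
  · intro N hN
    have halt : ∀ {u v : V} (h : G.Adj u v) (i : ℕ), i < P.len h →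
        (P.edge h i ∈ N ↔ (Even i ↔ P.edge h 0 ∈ N)) := by
      intro u v h i hi
      induction i with
      | zero => simp
      | succ i ih =>
        have h1 := (existsUnique_interior h (Nat.succ_pos i) hi
          (fun f hf _ => hpath f (hN.1 hf))).1 (hN.2 _)
        rw [Nat.succ_eq_add_one, Nat.add_sub_cancel, ih (by omega)] at h1
        rw [h1, Nat.even_add_one]
        tauto
    have hsymm : ∀ {u v : V} (h : G.Adj u v), P.edge h.symm 0 ∈ N → P.edge h 0 ∈ N := by
      intro u v h h0
      have hp := len_pos (P := P) h
      rw [edge_symm h (j := P.len h - 1) (by omega), halt h _ (by omega)] at h0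
      exact h0.1 (Nat.Odd.sub_odd (hodd h) odd_one)
    let M : Set (Sym2 V) := {e | ∃ (u v : V) (h : G.Adj u v), e = s(u, v) ∧ P.edge h 0 ∈ N}
    have hM0 : ∀ {u v : V} (h : G.Adj u v), P.edge h 0 ∈ N ↔ s(u, v) ∈ M := by
      intro u v h
      refine ⟨fun h0 => ⟨u, v, h, rfl, h0⟩, ?_⟩
      rintro ⟨a, b, h', hs, h0⟩
      rcases Sym2.eq_iff.1 hs with ⟨rfl, rfl⟩ | ⟨rfl, rfl⟩
      · exact h0
      · exact hsymm h h0
    have hME : M ⊆ G.edgeSet := by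
      rintro e ⟨u, v, h, rfl, -⟩
      exact h
    refine ⟨M, ⟨hME, fun v => ?_⟩, ?_⟩
    · exact (existsUnique_branch hME (fun f hf _ _ => hpath f (hN.1 hf)) hM0 v).1 (hN.2 _)
    · have key : ∀ f ∈ G'.edgeSet, f ∈ φ M ↔ f ∈ N := by
        intro f hf
        obtain ⟨u, v, h, -, i, hi, rfl⟩ := mem_pathEdges.1 (hpath f hf)
        rw [hφ M h hi, halt h i hi, hM0]
      ext f
      exact ⟨fun hf => (key f (hφE M hf)).1 hf, fun hf => (key f (hN.1 hf)).2 hf⟩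
  · intro f hf
    obtain ⟨u, v, h, -, i, hi, rfl⟩ := mem_pathEdges.1 (hpath f hf)
    refine ⟨s(u, v), h, ?_⟩
    by_cases hev : Even i
    · refine .inl ⟨fun M _ => ?_, fun h => h.elim⟩
      rw [hφ M h hi]
      tauto
    -- An odd position exists only on a path longer than one edge, so the replaced edge lies in `R`.
    · refine .inr ⟨?_, fun M _ => ?_⟩
      · by_contra hR
        rw [hone h hR, Nat.lt_one_iff] at hi
        exact hev (hi ▸ Even.zero)
      · rw [hφ M h hi]
        tauto
  · intro e he
    induction e using Sym2.ind with
    | _ u v =>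
      refine ⟨P.edge he 0, ?_, fun M _ => hφ0 M he⟩
      rw [hE]
      exact mem_pathEdges.2 ⟨u, v, he, trivial, 0, len_pos _, rfl⟩

end Bisubdivision

/-! ## Quadrilateral insertions -/

namespace PathReplacement

variable {V W : Type*} {G : SimpleGraph V} {G' : SimpleGraph W} {P : PathReplacement G G'}
  {u v a b : V}

/-- The chord of the `j`-th quadrilateral on the path replacing `uv`. -/
def chord (P : PathReplacement G G') {u v : V} (h : G.Adj u v) (j : ℕ) : Sym2 W :=
  s(P.vert h (4 * j + 1), P.vert h (4 * j + 4))

theorem mem_chord {h : G.Adj u v} {j : ℕ} {w : W} :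
    w ∈ P.chord h j ↔ w = P.vert h (4 * j + 1) ∨ w = P.vert h (4 * j + 4) := Sym2.mem_iff

theorem chord_symm (h : G.Adj u v) {i j : ℕ} (hij : 4 * (i + j) + 5 = P.len h) :
    P.chord h.symm i = P.chord h j := by
  rw [chord, chord, vert_symm h, vert_symm h, show P.len h - (4 * i + 1) = 4 * j + 4 by omega,
    show P.len h - (4 * i + 4) = 4 * j + 1 by omega, Sym2.eq_swap]

/-- The chords at an interior vertex. -/
theorem vert_mem_chord (h : G.Adj u v) (h' : G.Adj a b) (hlen : P.len h % 4 = 1) {i j : ℕ}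
    (hi0 : 0 < i) (hi : i < P.len h) (hj : 4 * j + 4 < P.len h') (hv : P.vert h i ∈ P.chord h' j) :
    ∃ j', (i = 4 * j' + 1 ∨ i = 4 * j' + 4) ∧ 4 * j' + 4 < P.len h ∧
      P.chord h' j = P.chord h j' := by
  rcases mem_chord.1 hv with h1 | h1
  · rcases eq_of_vert_eq h h' hi0 hi (by omega) h1 with ⟨rfl, rfl, rfl⟩ | ⟨rfl, rfl, h2⟩
    · exact ⟨j, .inl rfl, hj, rfl⟩
    · refine ⟨(P.len h - 5) / 4 - j, .inr ?_, ?_, chord_symm h ?_⟩ <;>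
      · rw [show h' = h.symm from rfl, len_symm h] at hj
        omega
  · rcases eq_of_vert_eq h h' hi0 hi (by omega) h1 with ⟨rfl, rfl, rfl⟩ | ⟨rfl, rfl, h2⟩
    · exact ⟨j, .inr rfl, hj, rfl⟩
    · refine ⟨(P.len h - 5) / 4 - j, .inl ?_, ?_, chord_symm h ?_⟩ <;>
      · rw [show h' = h.symm from rfl, len_symm h] at hj
        omega

theorem branch_notMem_chord (h : G.Adj u v) {j : ℕ} (hj : 4 * j + 4 < P.len h) (x : V) :
    P.branch x ∉ P.chord h j := by
  intro hx
  rcases mem_chord.1 hx with h1 | h1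
  · have := eq_zero_or_len h (by omega) h1
    omega
  · have := eq_zero_or_len h (by omega) h1
    omega

theorem edge_ne_chord (h : G.Adj u v) (h' : G.Adj a b) {i j : ℕ} (hi : i < P.len h)
    (hj : 4 * j + 4 < P.len h') : P.edge h i ≠ P.chord h' j := by
  intro h0
  have h1 : P.vert h' (4 * j + 1) ∈ P.edge h i := h0 ▸ mem_chord.2 (.inl rfl)
  have h2 : P.vert h' (4 * j + 4) ∈ P.edge h i := h0 ▸ mem_chord.2 (.inr rfl)
  rcases vert_mem_edge h' h (by omega) (by omega) hi h1 with h3 | h3 <;> rw [h3] at h2 <;>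
    rcases mem_edge.1 h2 with h4 | h4 <;>
    · have := vert_inj h' (by omega) (by omega) h4
      omega

/-- Chords start at positions `1` and end at positions `0` modulo `4`. As the length is `1` modulo
`4`, reversing the path exchanges these classes, so orientation decides which ends coincide. -/
theorem chord_inj (h : G.Adj u v) (h' : G.Adj a b) (hlen : P.len h % 4 = 1) {i j : ℕ}
    (hi : 4 * i + 4 < P.len h) (hj : 4 * j + 4 < P.len h') (hij : P.chord h i = P.chord h' j) :
    (a = u ∧ b = v ∧ j = i) ∨ (a = v ∧ b = u ∧ 4 * (i + j) + 5 = P.len h) := by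
  have hv : P.vert h (4 * i + 1) ∈ P.chord h' j := hij ▸ mem_chord.2 (.inl rfl)
  rcases mem_chord.1 hv with h1 | h1 <;>
    rcases eq_of_vert_eq h h' (by omega) (by omega) (by omega) h1 with ⟨rfl, rfl, h2⟩ | ⟨rfl, rfl, h2⟩
  · exact .inl ⟨rfl, rfl, by omega⟩
  · omega
  · omega
  · exact .inr ⟨rfl, rfl, by omega⟩

theorem existsUnique_interior_chord (hlen : ∀ {u v : V} (h : G.Adj u v), P.len h % 4 = 1)
    {N : Set (Sym2 W)} (hN : ∀ f ∈ N, f ∈ P.pathEdges Set.univ ∨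
      ∃ (u v : V) (h : G.Adj u v) (j : ℕ), 4 * j + 4 < P.len h ∧ f = P.chord h j)
    (h : G.Adj u v) {i j : ℕ} (hj : 4 * j + 4 < P.len h) (hi : i = 4 * j + 1 ∨ i = 4 * j + 4) :
    (∃! f, f ∈ N ∧ P.vert h i ∈ f) ↔
      (P.edge h (i - 1) ∈ N ∧ P.edge h i ∉ N ∧ P.chord h j ∉ N) ∨
      (P.edge h (i - 1) ∉ N ∧ P.edge h i ∈ N ∧ P.chord h j ∉ N) ∨
      (P.edge h (i - 1) ∉ N ∧ P.edge h i ∉ N ∧ P.chord h j ∈ N) := by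
  have hi0 : 0 < i := by omega
  have hil : i < P.len h := by omega
  have hstar : ∀ f ∈ N, P.vert h i ∈ f →
      f = P.edge h (i - 1) ∨ f = P.edge h i ∨ f = P.chord h j := by
    intro f hf hv
    rcases hN f hf with hf' | ⟨a, b, h', m, hm, rfl⟩
    · obtain ⟨a, b, h', -, m, hm, rfl⟩ := mem_pathEdges.1 hf'
      exact (vert_mem_edge h h' hi0 hil hm hv).imp_right .inl
    · obtain ⟨j', hj', -, h0⟩ := vert_mem_chord h h' (hlen h) hi0 hil hm hv
      obtain rfl : j' = j := by omega
      exact .inr (.inr h0)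
  have h1 := vert_mem_edge_pred (P := P) h hi0
  have h2 := vert_mem_edge_self (P := P) h i
  have h3 : P.vert h i ∈ P.chord h j := by
    rcases hi with rfl | rfl
    · exact mem_chord.2 (.inl rfl)
    · exact mem_chord.2 (.inr rfl)
  have hne1 := edge_ne_edge h hi0 hil
  have hne2 := edge_ne_chord h h hil hj
  have hne3 := edge_ne_chord h h (i := i - 1) (by omega) hj
  constructor
  · rintro ⟨f, ⟨hf, hv⟩, huniq⟩
    have := huniq (P.edge h (i - 1))
    have := huniq (P.edge h i)
    have := huniq (P.chord h j)
    have := hstar f hf hv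
    grind
  · rintro (h0 | h0 | h0)
    · exact ⟨_, ⟨h0.1, h1⟩, fun f hf => by have := hstar f hf.1 hf.2; grind⟩
    · exact ⟨_, ⟨h0.2.1, h2⟩, fun f hf => by have := hstar f hf.1 hf.2; grind⟩
    · exact ⟨_, ⟨h0.2.2, h3⟩, fun f hf => by have := hstar f hf.1 hf.2; grind⟩

/-- The perfect matching after inserting quadrilaterals that restricts to `M` and prefers the chord
of a quadrilateral if the chord belongs to `X`. -/
def quadMatching (P : PathReplacement G G') (M : Set (Sym2 V)) (X : Set (Sym2 W)) :
    Set (Sym2 W) :=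
  (P.pathSet fun {u v} h i => (i % 4 = 0 → s(u, v) ∈ M) ∧
    (i % 4 = 2 → s(u, v) ∈ M ∨ P.chord h (i / 4) ∈ X) ∧
    (i % 4 = 1 ∨ i % 4 = 3 → s(u, v) ∉ M ∧ P.chord h (i / 4) ∉ X)) ∪
  {f | ∃ (u v : V) (h : G.Adj u v) (j : ℕ), 4 * j + 4 < P.len h ∧ f = P.chord h j ∧
    s(u, v) ∉ M ∧ f ∈ X}

section

variable (hlen : ∀ {u v : V} (h : G.Adj u v), P.len h % 4 = 1) (M : Set (Sym2 V))
  (X : Set (Sym2 W))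
include hlen

theorem edge_mem_quadMatching (h : G.Adj u v) {i : ℕ} (hi : i < P.len h) :
    P.edge h i ∈ P.quadMatching M X ↔ (i % 4 = 0 → s(u, v) ∈ M) ∧
      (i % 4 = 2 → s(u, v) ∈ M ∨ P.chord h (i / 4) ∈ X) ∧
      (i % 4 = 1 ∨ i % 4 = 3 → s(u, v) ∉ M ∧ P.chord h (i / 4) ∉ X) := by
  have hne : ¬ ∃ (a b : V) (h' : G.Adj a b) (j : ℕ), 4 * j + 4 < P.len h' ∧
      P.edge h i = P.chord h' j ∧ s(a, b) ∉ M ∧ P.edge h i ∈ X := by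
    rintro ⟨a, b, h', j, hj, h0, -⟩
    exact edge_ne_chord h h' hi hj h0
  rw [quadMatching, Set.mem_union, Set.mem_ofPred_eq, or_iff_left hne]
  refine edge_mem_pathSet (fun {u v} h i j hij => ?_) h hi
  have h1 := hlen h
  rw [Sym2.eq_swap (a := v)]
  rintro ⟨h2, h3, h4⟩
  refine ⟨fun hj => h2 (by omega), fun hj => ?_, fun hj => ?_⟩
  · rw [← chord_symm h (i := i / 4) (by omega)]
    exact h3 (by omega)
  · rw [← chord_symm h (i := i / 4) (by omega)]
    exact h4 (by omega)

theorem edge_zero_mem_quadMatching (h : G.Adj u v) {j : ℕ} (hj : 4 * j < P.len h) :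
    P.edge h (4 * j) ∈ P.quadMatching M X ↔ s(u, v) ∈ M := by
  rw [edge_mem_quadMatching hlen M X h hj]
  simp

theorem edge_one_mem_quadMatching (h : G.Adj u v) {j : ℕ} (hj : 4 * j + 1 < P.len h) :
    P.edge h (4 * j + 1) ∈ P.quadMatching M X ↔ s(u, v) ∉ M ∧ P.chord h j ∉ X := by
  rw [edge_mem_quadMatching hlen M X h hj, show (4 * j + 1) % 4 = 1 by omega,
    show (4 * j + 1) / 4 = j by omega]
  simp

theorem edge_two_mem_quadMatching (h : G.Adj u v) {j : ℕ} (hj : 4 * j + 2 < P.len h) :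
    P.edge h (4 * j + 2) ∈ P.quadMatching M X ↔ s(u, v) ∈ M ∨ P.chord h j ∈ X := by
  rw [edge_mem_quadMatching hlen M X h hj, show (4 * j + 2) % 4 = 2 by omega,
    show (4 * j + 2) / 4 = j by omega]
  simp

theorem edge_three_mem_quadMatching (h : G.Adj u v) {j : ℕ} (hj : 4 * j + 3 < P.len h) :
    P.edge h (4 * j + 3) ∈ P.quadMatching M X ↔ s(u, v) ∉ M ∧ P.chord h j ∉ X := by
  rw [edge_mem_quadMatching hlen M X h hj, show (4 * j + 3) % 4 = 3 by omega,
    show (4 * j + 3) / 4 = j by omega]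
  simp

theorem chord_mem_quadMatching (h : G.Adj u v) {j : ℕ} (hj : 4 * j + 4 < P.len h) :
    P.chord h j ∈ P.quadMatching M X ↔ s(u, v) ∉ M ∧ P.chord h j ∈ X := by
  constructor
  · rintro (⟨a, b, h', i, hi, h0, -⟩ | ⟨a, b, h', i, hi, h0, h1⟩)
    · exact absurd h0.symm (edge_ne_chord h' h hi hj)
    · rcases chord_inj h h' (hlen h) hj hi h0 with ⟨rfl, rfl, -⟩ | ⟨rfl, rfl, -⟩
      · exact h1
      · rwa [Sym2.eq_swap]
  · exact fun h0 => .inr ⟨u, v, h, j, hj, rfl, h0⟩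

end

section

variable (hE : G'.edgeSet = P.pathEdges Set.univ ∪
    {f | ∃ (u v : V) (h : G.Adj u v) (j : ℕ), 4 * j + 4 < P.len h ∧ f = P.chord h j})
include hE

theorem quadMatching_subset (M : Set (Sym2 V)) (X : Set (Sym2 W)) :
    P.quadMatching M X ⊆ G'.edgeSet := by
  rw [hE]
  rintro f (⟨u, v, h, i, hi, rfl, -⟩ | ⟨u, v, h, j, hj, rfl, -⟩)
  · exact .inl (mem_pathEdges.2 ⟨u, v, h, trivial, i, hi, rfl⟩)
  · exact .inr ⟨u, v, h, j, hj, rfl⟩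

theorem mem_pathEdges_of_branch_mem {f : Sym2 W} (hf : f ∈ G'.edgeSet) (x : V)
    (hx : P.branch x ∈ f) : f ∈ P.pathEdges Set.univ := by
  rw [hE] at hf
  refine hf.resolve_right ?_
  rintro ⟨u, v, h, j, hj, rfl⟩
  exact branch_notMem_chord h hj x hx

end

section

variable (hlen : ∀ {u v : V} (h : G.Adj u v), P.len h % 4 = 1)
  (hE : G'.edgeSet = P.pathEdges Set.univ ∪
    {f | ∃ (u v : V) (h : G.Adj u v) (j : ℕ), 4 * j + 4 < P.len h ∧ f = P.chord h j})
include hlen hE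

/-- The condition at the interior vertices of the paths on an edge set to be a perfect matching. -/
theorem interior_iff {N : Set (Sym2 W)} (hN : N ⊆ G'.edgeSet) :
    (∀ (u v : V) (h : G.Adj u v) (i : ℕ), 0 < i → i < P.len h →
      ∃! f, f ∈ N ∧ P.vert h i ∈ f) ↔
    ∀ (u v : V) (h : G.Adj u v) (j : ℕ), 4 * j + 4 < P.len h →
      (P.edge h (4 * j + 4) ∈ N ↔ P.edge h (4 * j) ∈ N) ∧
      (P.edge h (4 * j + 1) ∈ N ↔ P.edge h (4 * j) ∉ N ∧ P.chord h j ∉ N) ∧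
      (P.edge h (4 * j + 2) ∈ N ↔ P.edge h (4 * j) ∈ N ∨ P.chord h j ∈ N) ∧
      (P.edge h (4 * j + 3) ∈ N ↔ P.edge h (4 * j) ∉ N ∧ P.chord h j ∉ N) ∧
      (P.chord h j ∈ N → P.edge h (4 * j) ∉ N) := by
  have hN' : ∀ f ∈ N, f ∈ P.pathEdges Set.univ ∨
      ∃ (u v : V) (h : G.Adj u v) (j : ℕ), 4 * j + 4 < P.len h ∧ f = P.chord h j := by
    intro f hf
    have := hN hf
    rwa [hE] at this
  have hmid : ∀ {u v : V} (h : G.Adj u v) {i : ℕ}, i < P.len h → (i % 4 = 2 ∨ i % 4 = 3) →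
      ∀ f ∈ N, P.vert h i ∈ f → f ∈ P.pathEdges Set.univ := by
    intro u v h i hi h4 f hf hv
    refine (hN' f hf).resolve_right ?_
    rintro ⟨a, b, h', j, hj, rfl⟩
    obtain ⟨j', hj', -⟩ := vert_mem_chord h h' (hlen h) (by omega) hi hj hv
    omega
  have key : ∀ {u v : V} (h : G.Adj u v) (j : ℕ), 4 * j + 4 < P.len h →
      ((∃! f, f ∈ N ∧ P.vert h (4 * j + 1) ∈ f) ∧ (∃! f, f ∈ N ∧ P.vert h (4 * j + 2) ∈ f) ∧
        (∃! f, f ∈ N ∧ P.vert h (4 * j + 3) ∈ f) ∧ (∃! f, f ∈ N ∧ P.vert h (4 * j + 4) ∈ f) ↔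
      (P.edge h (4 * j + 4) ∈ N ↔ P.edge h (4 * j) ∈ N) ∧
      (P.edge h (4 * j + 1) ∈ N ↔ P.edge h (4 * j) ∉ N ∧ P.chord h j ∉ N) ∧
      (P.edge h (4 * j + 2) ∈ N ↔ P.edge h (4 * j) ∈ N ∨ P.chord h j ∈ N) ∧
      (P.edge h (4 * j + 3) ∈ N ↔ P.edge h (4 * j) ∉ N ∧ P.chord h j ∉ N) ∧
      (P.chord h j ∈ N → P.edge h (4 * j) ∉ N)) := by
    intro u v h j hj
    rw [existsUnique_interior_chord hlen hN' h hj (.inl rfl),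
      existsUnique_interior_chord hlen hN' h hj (.inr rfl),
      existsUnique_interior h (by omega) (by omega) (hmid h (by omega) (.inl (by omega))),
      existsUnique_interior h (by omega) (by omega) (hmid h (by omega) (.inr (by omega)))]
    simp only [Nat.add_one_sub_one, show 4 * j + 2 - 1 = 4 * j + 1 by omega,
      show 4 * j + 3 - 1 = 4 * j + 2 by omega, show 4 * j + 4 - 1 = 4 * j + 3 by omega]
    -- What remains is propositional in the membership of five consecutive path edges and the chord.
    generalize (P.edge h (4 * j) ∈ N) = a₀, (P.edge h (4 * j + 1) ∈ N) = a₁,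
      (P.edge h (4 * j + 2) ∈ N) = a₂, (P.edge h (4 * j + 3) ∈ N) = a₃,
      (P.edge h (4 * j + 4) ∈ N) = a₄, (P.chord h j ∈ N) = c
    clear * -
    by_cases a₀ <;> by_cases c <;> by_cases a₁ <;> by_cases a₂ <;> simp_all <;> tauto
  constructor
  · intro H u v h j hj
    exact (key h j hj).1 ⟨H u v h _ (by omega) (by omega), H u v h _ (by omega) (by omega),
      H u v h _ (by omega) (by omega), H u v h _ (by omega) (by omega)⟩
  · intro H u v h i hi0 hi
    have h1 := hlen h
    have hj : 4 * ((i - 1) / 4) + 4 < P.len h := by omega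
    obtain ⟨c1, c2, c3, c4⟩ := (key h ((i - 1) / 4) hj).2 (H u v h _ hj)
    have : i = 4 * ((i - 1) / 4) + 1 ∨ i = 4 * ((i - 1) / 4) + 2 ∨ i = 4 * ((i - 1) / 4) + 3 ∨
        i = 4 * ((i - 1) / 4) + 4 := by omega
    rcases this with h0 | h0 | h0 | h0 <;> rw [h0] <;> assumption

theorem quadMatching_mem {M : Set (Sym2 V)} (hM : M ∈ matchingSets G) (X : Set (Sym2 W)) :
    P.quadMatching M X ∈ matchingSets G' := by
  have hsub := quadMatching_subset hE M X
  refine ⟨hsub, fun w => ?_⟩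
  rcases P.vertex_cases w with ⟨v, rfl⟩ | ⟨u, v, h, i, hi0, hi, rfl⟩
  · rw [existsUnique_branch hM.1
      (fun f hf x hx => mem_pathEdges_of_branch_mem hE (hsub hf) x hx)
      (fun h => edge_zero_mem_quadMatching hlen M X h (j := 0) (len_pos h))]
    exact hM.2 v
  · refine (interior_iff hlen hE hsub).2 (fun u v h j hj => ?_) u v h i hi0 hi
    have h4 : P.edge h (4 * j + 4) ∈ P.quadMatching M X ↔ s(u, v) ∈ M :=
      edge_zero_mem_quadMatching hlen M X h (j := j + 1) (by omega)
    rw [h4, edge_zero_mem_quadMatching hlen M X h (by omega),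
      edge_one_mem_quadMatching hlen M X h (by omega),
      edge_two_mem_quadMatching hlen M X h (by omega),
      edge_three_mem_quadMatching hlen M X h (by omega),
      chord_mem_quadMatching hlen M X h (by omega)]
    tauto

theorem exists_quadMatching_eq {N : Set (Sym2 W)} (hN : N ∈ matchingSets G') :
    ∃ M ∈ matchingSets G, ∃ X, P.quadMatching M X = N := by
  have hint := (interior_iff hlen hE hN.1).1 fun u v h i _ _ => hN.2 (P.vert h i)
  have hzero : ∀ {u v : V} (h : G.Adj u v) (j : ℕ), 4 * j < P.len h →
      (P.edge h (4 * j) ∈ N ↔ P.edge h 0 ∈ N) := by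
    intro u v h j hj
    induction j with
    | zero => rfl
    | succ j ih => exact (hint u v h j (by omega)).1.trans (ih (by omega))
  have hsymm : ∀ {u v : V} (h : G.Adj u v), P.edge h.symm 0 ∈ N → P.edge h 0 ∈ N := by
    intro u v h h0
    have h1 := hlen h
    -- The length is `1` modulo `4`, so this index is that of the last edge.
    rw [edge_symm h (j := 4 * (P.len h / 4)) (by omega), hzero h _ (by omega)] at h0
    exact h0
  let M : Set (Sym2 V) := {e | ∃ (u v : V) (h : G.Adj u v), e = s(u, v) ∧ P.edge h 0 ∈ N}
  have hM0 : ∀ {u v : V} (h : G.Adj u v), P.edge h 0 ∈ N ↔ s(u, v) ∈ M := by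
    intro u v h
    refine ⟨fun h0 => ⟨u, v, h, rfl, h0⟩, ?_⟩
    rintro ⟨a, b, h', hs, h0⟩
    rcases Sym2.eq_iff.1 hs with ⟨rfl, rfl⟩ | ⟨rfl, rfl⟩
    · exact h0
    · exact hsymm h h0
  have hME : M ⊆ G.edgeSet := by
    rintro e ⟨u, v, h, rfl, -⟩
    exact h
  -- Only chords are ever looked up in `X`, so `N` itself can serve as the set of chosen chords.
  refine ⟨M, ⟨hME, fun v => ?_⟩, N, ?_⟩
  · exact (existsUnique_branch hME
      (fun f hf x hx => mem_pathEdges_of_branch_mem hE (hN.1 hf) x hx) hM0 v).1 (hN.2 _)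
  · have key : ∀ f ∈ G'.edgeSet, f ∈ P.quadMatching M N ↔ f ∈ N := by
      intro f hf
      rw [hE] at hf
      rcases hf with hf | ⟨u, v, h, j, hj, rfl⟩
      · obtain ⟨u, v, h, -, i, hi, rfl⟩ := mem_pathEdges.1 hf
        have h1 := hlen h
        have : i = 4 * (i / 4) ∨ i = 4 * (i / 4) + 1 ∨ i = 4 * (i / 4) + 2 ∨
          i = 4 * (i / 4) + 3 := by omega
        generalize i / 4 = j at this
        rcases this with rfl | rfl | rfl | rfl
        · rw [edge_zero_mem_quadMatching hlen M N h hi, hzero h j hi, hM0]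
        · have := hint u v h j (by omega)
          rw [edge_one_mem_quadMatching hlen M N h hi, ← hM0 h, ← hzero h j (by omega)]
          tauto
        · have := hint u v h j (by omega)
          rw [edge_two_mem_quadMatching hlen M N h hi, ← hM0 h, ← hzero h j (by omega)]
          tauto
        · have := hint u v h j (by omega)
          rw [edge_three_mem_quadMatching hlen M N h hi, ← hM0 h, ← hzero h j (by omega)]
          tauto
      · have := hint u v h j (by omega)
        rw [chord_mem_quadMatching hlen M N h hj, ← hM0 h, ← hzero h j (by omega)]
        tauto
    ext f
    exact ⟨fun hf => (key f (quadMatching_subset hE M N hf)).1 hf,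
      fun hf => (key f (hN.1 hf)).2 hf⟩

end

/-- Inserting quadrilaterals raises both forcing numbers by the number of added chords. -/
theorem exists_forcingNumbersEq [Nonempty V] [Finite W] {R T : Set (Sym2 V)} {g : ℕ}
    (hg : ForcingNumbersEq G.edgeSet (matchingSets G) (R ∪ T) T g)
    (hP : P.IsQuadrilateralInsertion T) :
    ∃ g', ForcingNumbersEq G'.edgeSet (matchingSets G') (P.pathEdges (R ∪ T)) ∅ g' := by
  classical
  obtain ⟨k, hk, hlen', hE⟩ := hP
  replace hlen' : ∀ {u v : V} (h : G.Adj u v), P.len h = 4 * k s(u, v) + 1 := hlen'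
  have hlen : ∀ {u v : V} (h : G.Adj u v), P.len h % 4 = 1 := fun h => by
    rw [hlen' h]
    omega
  replace hE : G'.edgeSet = P.pathEdges Set.univ ∪
      {f | ∃ (u v : V) (h : G.Adj u v) (j : ℕ), 4 * j + 4 < P.len h ∧ f = P.chord h j} := by
    rw [hE]
    congr 1
    ext f
    constructor <;> rintro ⟨u, v, h, j, hj, rfl⟩ <;> refine ⟨u, v, h, j, ?_, rfl⟩ <;>
    · have := hlen' h
      omega
  have hT : ∀ {u v : V} (h : G.Adj u v) {j : ℕ}, 4 * j + 4 < P.len h → s(u, v) ∈ T := by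
    intro u v h j hj
    by_contra h0
    rw [hlen' h, hk _ h0] at hj
    omega
  have : Nonempty W := ⟨P.branch (Classical.arbitrary V)⟩
  have : Nonempty (Sym2 V) := ⟨s(Classical.arbitrary V, Classical.arbitrary V)⟩
  have : Nonempty (Sym2 W) := ⟨s(Classical.arbitrary W, Classical.arbitrary W)⟩
  let C : Finset (Sym2 W) := (Set.toFinite {f | ∃ (u v : V) (h : G.Adj u v) (j : ℕ),
    4 * j + 4 < P.len h ∧ f = P.chord h j}).toFinset
  have hC : ∀ c, c ∈ C ↔ ∃ (u v : V) (h : G.Adj u v) (j : ℕ),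
      4 * j + 4 < P.len h ∧ c = P.chord h j := fun c => Set.Finite.mem_toFinset _
  -- The owner of a chord is well defined by `chord_inj`.
  obtain ⟨o, ho⟩ : ∃ o : Sym2 W → Sym2 V, ∀ {u v : V} (h : G.Adj u v) {j : ℕ},
      4 * j + 4 < P.len h → o (P.chord h j) = s(u, v) := by
    have : ∀ c ∈ C, ∃ e : Sym2 V, ∃ (u v : V) (h : G.Adj u v) (j : ℕ),
        4 * j + 4 < P.len h ∧ c = P.chord h j ∧ e = s(u, v) := by
      intro c hc
      obtain ⟨u, v, h, j, hj, rfl⟩ := (hC c).1 hc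
      exact ⟨_, u, v, h, j, hj, rfl, rfl⟩
    choose! o ho using this
    refine ⟨o, fun {u v} h j hj => ?_⟩
    obtain ⟨a, b, h', i, hi, h0, h1⟩ := ho (P.chord h j) ((hC _).2 ⟨u, v, h, j, hj, rfl⟩)
    rw [h1]
    rcases chord_inj h h' (hlen h) hj hi h0 with ⟨rfl, rfl, -⟩ | ⟨rfl, rfl, -⟩
    · rfl
    · exact Sym2.eq_swap
  have hpath : ∀ {u v : V} (h : G.Adj u v) {i : ℕ}, i < P.len h → P.edge h i ∈ G'.edgeSet := by
    intro u v h i hi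
    rw [hE]
    exact .inl (mem_pathEdges.2 ⟨u, v, h, trivial, i, hi, rfl⟩)
  have hQ : QuadrilateralSystem G.edgeSet (matchingSets G) (R ∪ T) T G'.edgeSet
      (matchingSets G') (P.pathEdges (R ∪ T)) C o P.quadMatching := by
    refine ⟨fun N hN => hN.1, ?_, ?_, ?_, ?_, fun M hM X => quadMatching_mem hlen hE hM X,
      fun N hN => exists_quadMatching_eq hlen hE hN, ?_, ?_, ?_, ?_⟩
    · intro c hc
      rw [hE]
      exact .inr ((hC c).1 hc)
    · intro c hc hcR
      obtain ⟨u, v, h, j, hj, rfl⟩ := (hC c).1 hc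
      obtain ⟨a, b, h', -, i, hi, h0⟩ := mem_pathEdges.1 hcR
      exact edge_ne_chord h' h hi hj h0.symm
    · intro c hc
      obtain ⟨u, v, h, j, hj, rfl⟩ := (hC c).1 hc
      rw [ho h hj]
      exact h
    · intro c hc
      obtain ⟨u, v, h, j, hj, rfl⟩ := (hC c).1 hc
      rw [ho h hj]
      exact hT h hj
    · intro c hc M _ X
      obtain ⟨u, v, h, j, hj, rfl⟩ := (hC c).1 hc
      rw [ho h hj]
      exact chord_mem_quadMatching hlen M X h hj
    · intro e he
      induction e using Sym2.ind with
      | _ u v =>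
        exact ⟨P.edge he 0, hpath he (len_pos _), fun M _ X =>
          edge_zero_mem_quadMatching hlen M X he (j := 0) (len_pos _)⟩
    · intro c hc
      obtain ⟨u, v, h, j, hj, rfl⟩ := (hC c).1 hc
      refine ⟨P.edge h (4 * j + 1), hpath h (by omega), fun M _ X => ?_⟩
      rw [ho h hj]
      exact edge_one_mem_quadMatching hlen M X h (by omega)
    · intro f hf
      rw [hE] at hf
      rcases hf with hf | hf
      · obtain ⟨u, v, h, -, i, hi, rfl⟩ := mem_pathEdges.1 hf
        have h1 := hlen h
        have : i = 4 * (i / 4) ∨ i = 4 * (i / 4) + 1 ∨ i = 4 * (i / 4) + 2 ∨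
          i = 4 * (i / 4) + 3 := by omega
        generalize i / 4 = j at this
        rcases this with rfl | hi'
        · exact .inl ⟨s(u, v), h, fun M _ X => edge_zero_mem_quadMatching hlen M X h hi,
            (edge_mem_pathEdges h hi).1⟩
        · have hj : 4 * j + 4 < P.len h := by omega
          refine .inr ⟨P.chord h j, (hC _).2 ⟨u, v, h, j, hj, rfl⟩, .inr ?_⟩
          rw [ho h hj]
          rcases hi' with rfl | rfl | rfl
          · exact .inl fun M _ X => edge_one_mem_quadMatching hlen M X h hi
          · exact .inr fun M _ X => edge_two_mem_quadMatching hlen M X h hi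
          · exact .inl fun M _ X => edge_three_mem_quadMatching hlen M X h hi
      · exact .inr ⟨f, (hC f).2 hf, .inl rfl⟩
  exact ⟨_, hQ.forcingNumbersEq hg⟩

end PathReplacement

/-! ## Computing forcing numbers of finite set systems -/

section Computation

variable {α : Type*} [DecidableEq α]

/-- Whether at most `g` elements suffice to meet all members of a list of finite sets. -/
def hittable : ℕ → List (List α) → Bool
  | _, [] => true
  | 0, _ :: _ => false
  | g + 1, d :: l => d.any fun e => hittable g (l.filter fun d' => !d'.contains e)

/-- Completeness of the branching: some element of `S` lies in the first list, and on that branch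
the rest of `S` meets the lists that survive. -/
theorem hittable_of_forall_exists (l : List (List α)) (g : ℕ) (S : Finset α) (hg : S.card ≤ g)
    (hS : ∀ d ∈ l, ∃ e ∈ S, e ∈ d) : hittable g l = true := by
  induction g generalizing l S with
  | zero =>
    cases l with
    | nil => rfl
    | cons d l =>
      obtain ⟨e, he, -⟩ := hS d List.mem_cons_self
      have := Finset.card_pos.2 ⟨e, he⟩
      omega
  | succ g ih =>
    cases l with
    | nil => rfl
    | cons d l =>
      obtain ⟨e, he, hed⟩ := hS d List.mem_cons_self
      rw [hittable, List.any_eq_true]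
      refine ⟨e, hed, ih _ (S.erase e) ?_ ?_⟩
      · rw [Finset.card_erase_of_mem he]
        omega
      · intro d' hd'
        rw [List.mem_filter] at hd'
        obtain ⟨x, hx, hxd⟩ := hS d' (List.mem_cons_of_mem _ hd'.1)
        refine ⟨x, Finset.mem_erase.2 ⟨?_, hx⟩, hxd⟩
        rintro rfl
        simp [hxd] at hd'

/-- The last clause keeps the hitting set inside the union of the lists, hence inside the ground set
and, for lists `N \ M`, outside `M`. -/
theorem exists_of_hittable (g : ℕ) (l : List (List α)) (h : hittable g l = true) :
    ∃ S : Finset α, S.card ≤ g ∧ (∀ d ∈ l, ∃ e ∈ S, e ∈ d) ∧ ∀ e ∈ S, ∃ d ∈ l, e ∈ d := by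
  induction g generalizing l with
  | zero =>
    cases l with
    | nil => exact ⟨∅, by simp⟩
    | cons d l => simp [hittable] at h
  | succ g ih =>
    cases l with
    | nil => exact ⟨∅, by simp⟩
    | cons d l =>
      rw [hittable, List.any_eq_true] at h
      obtain ⟨e, he, h⟩ := h
      obtain ⟨S, hSg, hS, hS'⟩ := ih _ h
      refine ⟨insert e S, (Finset.card_insert_le _ _).trans (by omega), ?_, ?_⟩
      · intro d' hd'
        by_cases hed : e ∈ d'
        · exact ⟨e, Finset.mem_insert_self _ _, hed⟩
        · rcases List.mem_cons.1 hd' with rfl | hd'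
          · exact absurd he hed
          · obtain ⟨x, hx, hxd⟩ := hS d' (List.mem_filter.2 ⟨hd', by simp [hed]⟩)
            exact ⟨x, Finset.mem_insert_of_mem hx, hxd⟩
      · intro x hx
        rcases Finset.mem_insert.1 hx with rfl | hx
        · exact ⟨d, List.mem_cons_self, he⟩
        · obtain ⟨d', hd', hxd⟩ := hS' x hx
          exact ⟨d', List.mem_cons_of_mem _ (List.mem_filter.1 hd').1, hxd⟩

/-- The elements of `c` outside `d`. -/
def listSdiff (c d : List α) : List α := c.filter fun e => !d.contains e

theorem mem_listSdiff {c d : List α} {e : α} : e ∈ listSdiff c d ↔ e ∈ c ∧ e ∉ d := by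
  simp [listSdiff]

/-- The members of `L` that differ from `c` as sets. -/
def othersThan (L : List (List α)) (c : List α) : List (List α) :=
  L.filter fun d => !(listSdiff c d).isEmpty || !(listSdiff d c).isEmpty

theorem mem_othersThan {L : List (List α)} {c d : List α} :
    d ∈ othersThan L c ↔ d ∈ L ∧ {e | e ∈ c} ≠ {e | e ∈ d} := by
  rw [othersThan, List.mem_filter]
  refine and_congr_right fun _ => ?_
  rw [← not_iff_not]
  simp only [Bool.or_eq_true, Bool.not_eq_true', List.isEmpty_eq_false_iff, not_or, ne_eq, not_not,
    List.eq_nil_iff_forall_not_mem, mem_listSdiff, Set.ext_iff, Set.mem_ofPred_eq]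
  constructor
  · rintro ⟨h1, h2⟩ e
    have := h1 e; have := h2 e; tauto
  · exact fun h => ⟨fun e he => he.2 ((h e).1 he.1), fun e he => he.2 ((h e).2 he.1)⟩

/-- The symmetric differences of distinct members of `L`. -/
def symmDiffs (L : List (List α)) : List (List α) :=
  L.flatMap fun c => (othersThan L c).map fun d => listSdiff c d ++ listSdiff d c

/-- Decides the equality of forcing numbers for the set system `L` on the ground set `E`. -/
def checkForcing (E : List α) (L : List (List α)) (R T : List α) (g : ℕ) : Bool :=
  (L.all fun c => c.all E.contains) &&
  hittable (g + 1) (symmDiffs L) && !hittable g (symmDiffs L) &&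
  (L.all fun c => hittable (g + 1) ((othersThan L c).map fun d => listSdiff d c)) &&
  L.any fun c => (T.all fun e => !c.contains e) &&
    !hittable g ((othersThan L c).map fun d =>
      listSdiff d c ++ (listSdiff c d).filter fun e => R.contains e)

/-- Success with `g + 1` and failure with `g` pin down the least hitting sets. For the strengthened
lower bound, `N \ M` is enlarged by `(M \ N) ∩ R`, since prescribing such an element also excludes
`N`. -/
theorem forcingNumbersEq_of_check {E : List α} {L : List (List α)} {R T : List α} {g : ℕ}
    (h : checkForcing E L R T g = true) :
    ForcingNumbersEq {e | e ∈ E} {M | ∃ c ∈ L, M = {e | e ∈ c}} {e | e ∈ R} {e | e ∈ T} (g + 1) := by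
  simp only [checkForcing, Bool.and_eq_true, List.all_eq_true, List.any_eq_true,
    Bool.not_eq_true', List.contains_eq_mem, decide_eq_true_eq, decide_eq_false_iff_not] at h
  obtain ⟨⟨⟨⟨hE, h1⟩, h2⟩, h3⟩, c₀, hc₀, hT, h4⟩ := h
  refine ⟨?_, ?_, ?_, ?_, ?_⟩
  · rintro M ⟨c, hc, rfl⟩ e he
    exact hE c hc e he
  · obtain ⟨S, hSg, hS, hS'⟩ := exists_of_hittable _ _ h1
    refine ⟨S, ?_, hSg, ?_⟩
    · intro e he
      obtain ⟨x, hx, hex⟩ := hS' e he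
      simp only [symmDiffs, List.mem_flatMap, List.mem_map] at hx
      obtain ⟨c, hc, d, hd, rfl⟩ := hx
      rcases List.mem_append.1 hex with hex | hex
      · exact hE c hc e (mem_listSdiff.1 hex).1
      · exact hE d (mem_othersThan.1 hd).1 e (mem_listSdiff.1 hex).1
    · rintro M ⟨c, hc, rfl⟩ N ⟨d, hd, rfl⟩ hagree
      by_contra hne
      obtain ⟨e, he, hex⟩ := hS (listSdiff c d ++ listSdiff d c)
        (List.mem_flatMap.2 ⟨c, hc, List.mem_map.2 ⟨d, mem_othersThan.2 ⟨hd, hne⟩, rfl⟩⟩)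
      have := hagree e he
      simp only [List.mem_append, mem_listSdiff, Set.mem_ofPred_eq] at hex this
      tauto
  · intro S _ hS
    by_contra hlt
    refine Bool.eq_false_iff.1 h2 (hittable_of_forall_exists _ g S (by omega) ?_)
    intro x hx
    simp only [symmDiffs, List.mem_flatMap, List.mem_map] at hx
    obtain ⟨c, hc, d, hd, rfl⟩ := hx
    rw [mem_othersThan] at hd
    by_contra hcon
    push Not at hcon
    refine hd.2 (hS _ ⟨c, hc, rfl⟩ _ ⟨d, hd.1, rfl⟩ fun e he => ?_)
    have := hcon e he
    simp only [List.mem_append, mem_listSdiff, Set.mem_ofPred_eq] at this ⊢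
    tauto
  · rintro M ⟨c, hc, rfl⟩
    obtain ⟨S, hSg, hS, hS'⟩ := exists_of_hittable _ _ (h3 c hc)
    refine ⟨S, ?_, hSg, ?_⟩
    · intro e he
      obtain ⟨x, hx, hex⟩ := hS' e he
      obtain ⟨d, hd, rfl⟩ := List.mem_map.1 hx
      rw [mem_listSdiff] at hex
      exact ⟨hE d (mem_othersThan.1 hd).1 e hex.1, hex.2⟩
    · rintro N ⟨d, hd, rfl⟩ hdis
      by_contra hne
      obtain ⟨e, he, hex⟩ := hS (listSdiff d c)
        (List.mem_map.2 ⟨d, mem_othersThan.2 ⟨hd, Ne.symm hne⟩, rfl⟩)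
      exact hdis e he (mem_listSdiff.1 hex).1
  · refine ⟨{e | e ∈ c₀}, ⟨c₀, hc₀, rfl⟩, hT, fun S _ hSR hS => ?_⟩
    by_contra hlt
    refine Bool.eq_false_iff.1 h4 (hittable_of_forall_exists _ g S (by omega) ?_)
    intro x hx
    obtain ⟨d, hd, rfl⟩ := List.mem_map.1 hx
    rw [mem_othersThan] at hd
    by_contra hcon
    push Not at hcon
    refine hd.2 (hS _ ⟨d, hd.1, rfl⟩ fun e he => ?_).symm
    have h5 := hcon e he
    have h6 := hSR e he
    simp only [List.mem_append, List.mem_filter, mem_listSdiff, Set.mem_ofPred_eq,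
      decide_eq_true_eq] at h5 h6 ⊢
    tauto

/-- Lists that meet every member of `stars`, extending `cur`, found by branching; elements that
`meets` relates are never chosen together. -/
def covers (meets : α → α → Bool) : List (List α) → List α → List (List α)
  | [], cur => [cur]
  | s :: stars, cur =>
    if s.any cur.contains then covers meets stars cur
    else (s.filter fun p => cur.all fun q => !meets p q).flatMap fun p =>
      covers meets stars (p :: cur)

/-- At each star not yet met, the branch through an element of `M` is followed; the filter keeps it
because distinct elements of `M` never meet. -/
theorem exists_mem_covers {meets : α → α → Bool} {M : Set α}
    (hM : ∀ p ∈ M, ∀ q ∈ M, meets p q = true → p = q) (stars : List (List α)) (cur : List α)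
    (hstars : ∀ s ∈ stars, ∃ p ∈ s, p ∈ M) (hcur : ∀ p ∈ cur, p ∈ M) :
    ∃ c ∈ covers meets stars cur, (∀ p ∈ c, p ∈ M) ∧ (∀ p ∈ cur, p ∈ c) ∧
      ∀ s ∈ stars, ∃ p ∈ s, p ∈ c := by
  induction stars generalizing cur with
  | nil => exact ⟨cur, by simp [covers], hcur, fun _ h => h, by simp⟩
  | cons s stars ih =>
    have hstars' : ∀ s ∈ stars, ∃ p ∈ s, p ∈ M := fun t ht => hstars t (List.mem_cons_of_mem _ ht)
    by_cases hs : s.any cur.contains = true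
    · obtain ⟨c, hc, h1, h2, h3⟩ := ih cur hstars' hcur
      refine ⟨c, by rwa [covers, if_pos hs], h1, h2, ?_⟩
      intro t ht
      rcases List.mem_cons.1 ht with rfl | ht
      · obtain ⟨p, hp, hpc⟩ := List.any_eq_true.1 hs
        exact ⟨p, hp, h2 p (by simpa using hpc)⟩
      · exact h3 t ht
    · obtain ⟨p, hp, hpM⟩ := hstars s List.mem_cons_self
      have hpcur : p ∉ cur := fun h => hs (List.any_eq_true.2 ⟨p, hp, by simpa using h⟩)
      obtain ⟨c, hc, h1, h2, h3⟩ := ih (p :: cur) hstars' (by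
        intro q hq
        rcases List.mem_cons.1 hq with rfl | hq
        · exact hpM
        · exact hcur q hq)
      refine ⟨c, ?_, h1, fun q hq => h2 q (List.mem_cons_of_mem _ hq), ?_⟩
      · rw [covers, if_neg hs, List.mem_flatMap]
        refine ⟨p, List.mem_filter.2 ⟨hp, List.all_eq_true.2 fun q hq => ?_⟩, hc⟩
        rw [Bool.not_eq_true', Bool.eq_false_iff]
        intro hpq
        exact hpcur (hM p hpM q (hcur q hq) hpq ▸ hq)
      · intro t ht
        rcases List.mem_cons.1 ht with rfl | ht
        · exact ⟨p, hp, h2 p List.mem_cons_self⟩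
        · exact h3 t ht

end Computation

/-! ## The fundamental graphs -/

namespace FundamentalGraph

/-- The labels of the edges of a fundamental graph. -/
def pairs (F : FundamentalGraph) : List (ℕ × ℕ) := cyclePairs F.order ++ F.chords

/-- Whether `v` is a label of an end of the edge labelled `p`. -/
def incident (v : ℕ) (p : ℕ × ℕ) : Bool := p.1 == v || p.2 == v

/-- Whether the edges labelled `p` and `q` have a common end. -/
def meets (p q : ℕ × ℕ) : Bool := incident p.1 q || incident p.2 q

/-- The perfect matchings of a fundamental graph as lists of labels. -/
def matchings (F : FundamentalGraph) : List (List (ℕ × ℕ)) :=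
  covers meets ((List.range F.order).map fun v => F.pairs.filter (incident (v + 1))) []

/-- Decides whether the forcing numbers of a fundamental graph are equal to `g + 1`. -/
def check (F : FundamentalGraph) (R T : List (ℕ × ℕ)) (g : ℕ) : Bool :=
  F.order != 0 &&
  (F.pairs.all fun p => p.1 != 0 && Nat.ble p.1 F.order && p.2 != 0 && Nat.ble p.2 F.order &&
    p.1 != p.2 && !F.pairs.contains (p.2, p.1)) &&
  (R.all fun p => F.pairs.contains p) && (T.all fun p => F.pairs.contains p) &&
  (F.matchings.all fun c => (List.range F.order).all fun v =>
    (c.filter (incident (v + 1))).length == 1) &&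
  checkForcing F.pairs F.matchings R T g

/-- No edge carries two labels, because reversed pairs are excluded, so sets of labels correspond to
sets of edges. The enumeration misses no perfect matching by `exists_mem_covers`, and the count at
each vertex shows that it lists nothing else. -/
theorem forcingNumbersEq {F : FundamentalGraph} {R T : List (ℕ × ℕ)} {g : ℕ}
    (h : F.check R T g = true) :
    Nonempty (Fin F.order) ∧ ForcingNumbersEq F.graph.edgeSet (matchingSets F.graph)
      (labelledEdges F.order R) (labelledEdges F.order T) (g + 1) := by
  simp only [check, Bool.and_eq_true, bne_iff_ne, ne_eq, List.all_eq_true, Bool.not_eq_true',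
    List.contains_eq_mem, decide_eq_true_eq, decide_eq_false_iff_not, beq_iff_eq, Nat.ble_eq,
    List.mem_range] at h
  obtain ⟨⟨⟨⟨⟨h0, hwf⟩, hR⟩, hT⟩, hlen⟩, hcheck⟩ := h
  have hsub : ∀ c ∈ F.matchings, ∀ p ∈ c, p ∈ F.pairs := by
    have h1 := (forcingNumbersEq_of_check hcheck).subset
    exact fun c hc p hp => h1 _ ⟨c, hc, rfl⟩ hp
  have hne : Nonempty (Fin F.order) := ⟨⟨0, Nat.pos_of_ne_zero h0⟩⟩
  have hcode : ∀ p ∈ F.pairs, ∃ a b : Fin F.order, p = (a.val + 1, b.val + 1) := by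
    intro p hp
    have := hwf p hp
    exact ⟨⟨p.1 - 1, by omega⟩, ⟨p.2 - 1, by omega⟩, by ext <;> simp <;> omega⟩
  have hunique : ∀ {a b a' b' : Fin F.order}, (a.val + 1, b.val + 1) ∈ F.pairs →
      (a'.val + 1, b'.val + 1) ∈ F.pairs → s(a, b) = s(a', b') → a = a' ∧ b = b' := by
    intro a b a' b' h1 h2 h3
    rcases Sym2.eq_iff.1 h3 with h3 | ⟨rfl, rfl⟩
    · exact h3
    · exact absurd h2 (hwf _ h1).2
  have hE : F.graph.edgeSet = labelledEdges F.order F.pairs := by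
    rw [graph, SimpleGraph.edgeSet_fromEdgeSet]
    refine sdiff_eq_left.2 (Set.disjoint_left.2 ?_)
    rintro e ⟨a, b, hab, rfl⟩ hdiag
    have h1 := hwf _ hab
    rw [Sym2.mem_diagSet, Sym2.mk_isDiag_iff] at hdiag
    exact h1.1.2 (by rw [hdiag])
  let φ : Set (ℕ × ℕ) → Set (Sym2 (Fin F.order)) := fun M =>
    {e | ∃ a b : Fin F.order, (a.val + 1, b.val + 1) ∈ M ∧ e = s(a, b)}
  have hφ : ∀ M : Set (ℕ × ℕ), M ⊆ {p | p ∈ F.pairs} → ∀ {a b : Fin F.order},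
      (a.val + 1, b.val + 1) ∈ F.pairs → (s(a, b) ∈ φ M ↔ (a.val + 1, b.val + 1) ∈ M) := by
    intro M hM a b hab
    constructor
    · rintro ⟨a', b', h1, h2⟩
      obtain ⟨rfl, rfl⟩ := hunique hab (hM h1) h2
      exact h1
    · exact fun h1 => ⟨a, b, h1, rfl⟩
  have hφE : ∀ M : Set (ℕ × ℕ), M ⊆ {p | p ∈ F.pairs} → φ M ⊆ F.graph.edgeSet := by
    rintro M hM e ⟨a, b, hab, rfl⟩
    rw [hE]
    exact ⟨a, b, hM hab, rfl⟩
  have hinc : ∀ {a b v : Fin F.order}, v ∈ s(a, b) ↔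
      incident (v.val + 1) (a.val + 1, b.val + 1) = true := by
    intro a b v
    simp only [incident, Sym2.mem_iff, Bool.or_eq_true, beq_iff_eq, Fin.ext_iff]
    omega
  have : Nonempty (Sym2 (Fin F.order)) := hne.map fun v => s(v, v)
  refine ⟨hne, (forcingNumbersEq_of_check hcheck).of_bijection φ (fun N hN => hN.1) ?_ ?_ ?_ ?_ ?_⟩
  · rintro M ⟨c, hc, rfl⟩
    refine ⟨hφE _ (hsub c hc), fun v => ?_⟩
    obtain ⟨p, hp⟩ := List.length_eq_one_iff.1 (hlen c hc v v.2)
    have hmem : ∀ q, q ∈ c ∧ incident (v.val + 1) q = true ↔ q = p := by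
      intro q
      rw [← List.mem_filter, hp, List.mem_singleton]
    obtain ⟨hpc, hpv⟩ := (hmem p).2 rfl
    obtain ⟨a, b, rfl⟩ := hcode p (hsub c hc p hpc)
    refine ⟨s(a, b), ⟨⟨a, b, hpc, rfl⟩, hinc.2 hpv⟩, ?_⟩
    rintro e ⟨⟨a', b', h1, rfl⟩, h2⟩
    have := (hmem _).1 ⟨h1, hinc.1 h2⟩
    simp only [Prod.mk.injEq, Nat.add_right_cancel_iff, ← Fin.ext_iff] at this
    rw [this.1, this.2]
  · intro N hN
    let M : Set (ℕ × ℕ) := {p | p ∈ F.pairs ∧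
      ∃ a b : Fin F.order, p = (a.val + 1, b.val + 1) ∧ s(a, b) ∈ N}
    have hMv : ∀ v : Fin F.order, ∃ p, p ∈ M ∧ incident (v.val + 1) p = true ∧
        ∀ q ∈ M, incident (v.val + 1) q = true → q = p := by
      intro v
      obtain ⟨e, ⟨he, hv⟩, huniq⟩ := hN.2 v
      have he' := hN.1 he
      rw [hE] at he'
      obtain ⟨a, b, hab, rfl⟩ := he'
      refine ⟨_, ⟨hab, a, b, rfl, he⟩, hinc.1 hv, ?_⟩
      rintro q ⟨hq, a', b', rfl, h1⟩ h2
      obtain ⟨rfl, rfl⟩ := hunique hq hab (huniq _ ⟨h1, hinc.2 h2⟩)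
      rfl
    have hMeq : ∀ p ∈ M, ∀ q ∈ M, ∀ v : Fin F.order, incident (v.val + 1) p = true →
        incident (v.val + 1) q = true → p = q := by
      intro p hp q hq v h1 h2
      obtain ⟨r, -, -, hr⟩ := hMv v
      rw [hr p hp h1, hr q hq h2]
    obtain ⟨c, hc, h1, -, h3⟩ := exists_mem_covers (meets := meets) (M := M) (by
        rintro p hp q hq hpq
        obtain ⟨-, a, b, rfl, -⟩ := id hp
        simp only [meets, Bool.or_eq_true] at hpq
        rcases hpq with hpq | hpq
        · exact hMeq _ hp q hq a (by simp [incident]) hpq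
        · exact hMeq _ hp q hq b (by simp [incident]) hpq)
      ((List.range F.order).map fun v => F.pairs.filter (incident (v + 1))) []
      (by
        intro s hs
        obtain ⟨v, hv, rfl⟩ := List.mem_map.1 hs
        obtain ⟨p, hp, hpv, -⟩ := hMv ⟨v, List.mem_range.1 hv⟩
        exact ⟨p, List.mem_filter.2 ⟨hp.1, hpv⟩, hp⟩) (by simp)
    refine ⟨{p | p ∈ c}, ⟨c, hc, rfl⟩, ?_⟩
    -- The list `c` lies in `M` and meets every star, while `M` has only one edge at each vertex.
    have hMc : M = {p | p ∈ c} := by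
      refine Set.Subset.antisymm ?_ h1
      intro p hp
      obtain ⟨-, a, b, rfl, -⟩ := id hp
      obtain ⟨q, hq, hqc⟩ := h3 _ (List.mem_map.2 ⟨a, List.mem_range.2 a.2, rfl⟩)
      rw [List.mem_filter] at hq
      have := hMeq _ hp q (h1 q hqc) a (by simp [incident]) hq.2
      rwa [this]
    rw [← hMc]
    ext e
    constructor
    · rintro ⟨a, b, ⟨-, a', b', h4, h5⟩, rfl⟩
      simp only [Prod.mk.injEq, Nat.add_right_cancel_iff, ← Fin.ext_iff] at h4
      rwa [h4.1, h4.2]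
    · intro he
      have he' := hN.1 he
      rw [hE] at he'
      obtain ⟨a, b, hab, rfl⟩ := he'
      exact ⟨a, b, ⟨hab, a, b, rfl, he⟩, rfl⟩
  · intro f hf
    rw [hE] at hf
    obtain ⟨a, b, hab, rfl⟩ := hf
    refine ⟨_, hab, .inl ⟨?_, ?_⟩⟩
    · rintro M ⟨c, hc, rfl⟩
      exact hφ _ (hsub c hc) hab
    · rintro ⟨a', b', h1, h2⟩
      obtain ⟨rfl, rfl⟩ := hunique hab (hR _ h1) h2
      exact h1
  · intro p hp
    obtain ⟨a, b, rfl⟩ := hcode p hp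
    refine ⟨s(a, b), ?_, ?_⟩
    · rw [hE]
      exact ⟨a, b, hp, rfl⟩
    · rintro M ⟨c, hc, rfl⟩
      exact hφ _ (hsub c hc) hp
  · rintro M ⟨c, hc, rfl⟩ hMT f ⟨a, b, hab, rfl⟩ hf
    exact hMT _ hab ((hφ _ (hsub c hc) (hT _ hab)).1 hf)

theorem exists_check_bisubdivision : ∀ F ∈ list0 ++ list1 ++ list2 ++ list3,
    ∀ R ∈ F.replaceable, ∃ g < 4, F.check R [] g = true := by
  decide +kernel

/-- The paths replacing edges of `T` are subdivided afterwards, so elements of `T` must be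
prescribable too; hence `R ++ T`. -/
theorem exists_check_quadrilateral : ∀ F ∈ list3', ∀ R ∈ F.replaceable, ∀ T ∈ F.strong,
    ∃ g < 4, F.check (R ++ T) T g = true := by
  decide +kernel

end FundamentalGraph

/-! ### The families of the lemma -/

theorem forcingNumbers_eq_of_bisubdivisionFamily {V : Type*} {G : SimpleGraph V}
    {L : List FundamentalGraph}
    (hL : ∀ F ∈ L, ∀ R ∈ F.replaceable, ∃ g < 4, F.check R [] g = true)
    (hG : G ∈ bisubdivisionFamily L V) :
    ∃ g, ForcingNumbersEq G.edgeSet (matchingSets G) ∅ ∅ g := by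
  obtain ⟨F, hF, R, hR, hG⟩ := hG
  obtain ⟨g, -, hg⟩ := hL F hF R hR
  obtain ⟨hne, hg⟩ := FundamentalGraph.forcingNumbersEq hg
  exact ⟨_, hg.bisubdivision hG⟩

theorem forcingNumbers_eq_of_quadBisubdivisionFamily {V : Type*} {G : SimpleGraph V}
    {L : List FundamentalGraph}
    (hL : ∀ F ∈ L, ∀ R ∈ F.replaceable, ∀ T ∈ F.strong, ∃ g < 4, F.check (R ++ T) T g = true)
    (hG : G ∈ quadBisubdivisionFamily L V) :
    ∃ g, ForcingNumbersEq G.edgeSet (matchingSets G) ∅ ∅ g := by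
  obtain ⟨F, hF, R, hR, T, hT, n, G₁, P, hP, hG⟩ := hG
  obtain ⟨g, -, hg⟩ := hL F hF R hR T hT
  obtain ⟨hne, hg⟩ := FundamentalGraph.forcingNumbersEq hg
  have hRT : labelledEdges F.order (R ++ T) = labelledEdges F.order R ∪ labelledEdges F.order T := by
    ext e
    simp only [labelledEdges, List.mem_append, Set.mem_union, Set.mem_ofPred_eq, or_and_right,
      exists_or]
  rw [hRT] at hg
  obtain ⟨g', hg'⟩ := PathReplacement.exists_forcingNumbersEq hg hP
  have : Nonempty (Fin n) := hne.map P.branch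
  exact ⟨_, hg'.bisubdivision hG⟩

theorem lemma4p3 {V : Type*} [Finite V] (G : SimpleGraph V)
    (hG : G ∈ family0 V ∪ family1 V ∪ family2 V ∪ family3 V) :
    (∃ M : G.Subgraph, M.IsPerfectMatching) ∧
      globalForcingNumber G = maxAntiForcingNumber G := by
  have key : ∃ g, ForcingNumbersEq G.edgeSet (matchingSets G) ∅ ∅ g := by
    have hL := FundamentalGraph.exists_check_bisubdivision
    rcases hG with ((hG | hG) | hG) | hG | hG
    · exact forcingNumbers_eq_of_bisubdivisionFamily (fun F hF => hL F (by simp [hF])) hG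
    · exact forcingNumbers_eq_of_bisubdivisionFamily (fun F hF => hL F (by simp [hF])) hG
    · exact forcingNumbers_eq_of_bisubdivisionFamily (fun F hF => hL F (by simp [hF])) hG
    · exact forcingNumbers_eq_of_bisubdivisionFamily (fun F hF => hL F (by simp [hF])) hG
    · exact forcingNumbers_eq_of_quadBisubdivisionFamily
        FundamentalGraph.exists_check_quadrilateral hG
  obtain ⟨g, hg⟩ := key
  obtain ⟨hM, hAf⟩ := hg.maxAntiForcingNumber_eq
  exact ⟨hM, hg.globalForcingNumber_eq.trans hAf.symm⟩
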